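/- A face of a finite simplicial complex is a nonempty simplex; write $|K|$ for the geometric realization of $K$. A *$k$-stacked $(d+1)$-ball* ($0\le k\le d$) is a finite simplicial complex $B$ with $|B|$ homeomorphic to the closed $(d+1)$-ball such that every $j$-face of $B$ with $0\le j\le d-k$ lies in the boundary complex $\partial B$ (the subcomplex generated by the $d$-faces contained in exactly one $(d+1)$-face). A *$k$-stacked $d$-sphere* is the boundary complex of a $k$-stacked $(d+1)$-ball. For $d\ge 1$, $\mathcal{K}^k(d)$ is the family of $d$-dimensional simplicial complexes all of whose vertex links are $k$-stacked $(d-1)$-spheres. A complex is *centrally symmetric* if it has a simplicial involution that maps no face to itself. A subcomplex $A$ of a polyhedral complex $L$ is *$k$-Hamiltonian* if $A$ contains the full $k$-skeleton of $L$. Let $\beta^8=\operatorname{conv}\{\pm e_1,\dots,\pm e_8\}\subset\mathbb{R}^8$ be the $8$-dimensional cross polytope. **Theorem.** There exists a simplicial complex $M^6_{16}$ with $16$ vertices such that 1. $|M^6_{16}|$ is homeomorphic to $S^4\times S^2$; 2. $M^6_{16}$ is centrally symmetric; 3. its $f$-vector is $(f_0,\dots,f_6)=(16,112,448,980,1232,840,240)$;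 4. $M^6_{16}$ is a $2$-Hamiltonian subcomplex of the boundary complex of $\beta^8$; 5. $M^6_{16}\in\mathcal{K}^2(6)$, that is, it is $6$-dimensional and all of its vertex links are $2$-stacked $5$-spheres. -/

import Mathlib

namespace PreAbstractSimplicialComplex

variable {V : Type*}

/-- The geometric realization of a simplicial complex on a finite vertex set, as a subspace of
`V → ℝ`: all systems of barycentric coordinates supported on a face. -/
def realization [Fintype V] (K : PreAbstractSimplicialComplex V) : Set (V → ℝ) :=
  {x | x ∈ stdSimplex ℝ V ∧ ∃ s ∈ K.faces, ∀ v, x v ≠ 0 → v ∈ s}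

/-- The realization of `K` is homeomorphic to `X`. -/
def Triangulates [Fintype V] (K : PreAbstractSimplicialComplex V) (X : Type*)
    [TopologicalSpace X] : Prop :=
  Nonempty (K.realization ≃ₜ X)

/-- The number of `i`-dimensional faces. -/
noncomputable def faceCount (K : PreAbstractSimplicialComplex V) (i : ℕ) : ℕ :=
  {s | s ∈ K.faces ∧ s.card = i + 1}.ncard

/-- The `f`-vector `(f₀, …, f_d)` of a `d`-dimensional complex. -/
noncomputable def fVector (d : ℕ) (K : PreAbstractSimplicialComplex V) : Fin (d + 1) → ℕ :=
  fun i => K.faceCount i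

/-- `K` is a complex of dimension `d`. -/
def HasDimension (d : ℕ) (K : PreAbstractSimplicialComplex V) : Prop :=
  (∃ s ∈ K.faces, s.card = d + 1) ∧ ∀ s ∈ K.faces, s.card ≤ d + 1

/-- The link of the vertex `v`. -/
def link [DecidableEq V] (K : PreAbstractSimplicialComplex V) (v : V) :
    PreAbstractSimplicialComplex V where
  faces := {s | s.Nonempty ∧ v ∉ s ∧ insert v s ∈ K.faces}
  isRelLowerSet_faces := by
    rintro s ⟨hs, hv, hK⟩
    refine ⟨hs, fun t hts ht => ⟨ht, fun h => hv (hts h), ?_⟩⟩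
    exact (K.isRelLowerSet_faces hK).2 (Finset.insert_subset_insert v hts)
      (Finset.insert_nonempty v t)

/-- The boundary of a triangulated `n`-manifold with boundary: the complex generated by
the `(n-1)`-faces that lie in exactly one `n`-face. -/
def boundary (n : ℕ) (B : PreAbstractSimplicialComplex V) : PreAbstractSimplicialComplex V where
  faces := {s | s.Nonempty ∧ ∃ t ∈ B.faces, s ⊆ t ∧ t.card = n ∧
    ∃! u, u ∈ B.faces ∧ t ⊆ u ∧ u.card = n + 1}
  isRelLowerSet_faces := by
    rintro s ⟨hs, t, ht, hst, h⟩
    exact ⟨hs, fun r hrs hr => ⟨hr, t, ht, hrs.trans hst, h⟩⟩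

/-- A `k`-stacked `(d+1)`-ball: a triangulated `(d+1)`-ball, `0 ≤ k ≤ d`, without interior
`j`-faces for `0 ≤ j ≤ d - k` (the interior faces are those outside the boundary complex). -/
def IsStackedBall [Fintype V] (k d : ℕ) (B : PreAbstractSimplicialComplex V) : Prop :=
  k ≤ d ∧ B.Triangulates (Metric.closedBall (0 : EuclideanSpace ℝ (Fin (d + 1))) 1) ∧
    ∀ j ≤ d - k, ∀ s ∈ B.faces, s.card = j + 1 → s ∈ (B.boundary (d + 1)).faces

/-- A `k`-stacked `d`-sphere: the boundary of a `k`-stacked `(d+1)`-ball. Since such a ball has no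
interior vertices, it uses no vertices other than those of the sphere. -/
def IsStackedSphere [Fintype V] (k d : ℕ) (S : PreAbstractSimplicialComplex V) : Prop :=
  ∃ B : PreAbstractSimplicialComplex V, B.IsStackedBall k d ∧ B.boundary (d + 1) = S

/-- The class `𝒦ᵏ(d)`, `d ≥ 1`: the `d`-dimensional complexes all of whose vertex links are
`k`-stacked `(d-1)`-spheres. -/
def InClassK [Fintype V] [DecidableEq V] (k d : ℕ) (K : PreAbstractSimplicialComplex V) : Prop :=
  1 ≤ d ∧ K.HasDimension d ∧ ∀ v, {v} ∈ K.faces → (K.link v).IsStackedSphere k (d - 1)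

/-- There is a combinatorial involution of `K` that fixes no face. -/
def IsCentrallySymmetric (K : PreAbstractSimplicialComplex V) : Prop :=
  ∃ σ : Equiv.Perm V, Function.Involutive σ ∧
    (∀ s, s ∈ K.faces ↔ s.map σ.toEmbedding ∈ K.faces) ∧
    ∀ s ∈ K.faces, s.map σ.toEmbedding ≠ s

/-- `A` is a `k`-Hamiltonian subcomplex of `L`: it contains the whole `k`-skeleton of `L`. -/
def IsHamiltonianSubcomplex (k : ℕ) (A L : PreAbstractSimplicialComplex V) : Prop :=
  A ≤ L ∧ ∀ s ∈ L.faces, s.card ≤ k + 1 → s ∈ A.faces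

end PreAbstractSimplicialComplex

namespace CrossPolytope

/-- The vertices `± e_i` of the `n`-dimensional cross polytope. -/
noncomputable def vertex (n : ℕ) (v : Fin n × Bool) : EuclideanSpace ℝ (Fin n) :=
  EuclideanSpace.single v.1 (if v.2 then (1 : ℝ) else -1)

/-- The `n`-dimensional cross polytope `βⁿ`. -/
def polytope (n : ℕ) : Set (EuclideanSpace ℝ (Fin n)) :=
  convexHull ℝ (Set.range (vertex n))

/-- The vertex set `s` spans a proper face of the cross polytope. -/
def SpansProperFace (n : ℕ) (s : Finset (Fin n × Bool)) : Prop :=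
  s.Nonempty ∧ IsExposed ℝ (polytope n) (convexHull ℝ (vertex n '' s)) ∧
    convexHull ℝ (vertex n '' s) ≠ polytope n

theorem spansProperFace_iff (n : ℕ) (s : Finset (Fin n × Bool)) :
    SpansProperFace n s ↔ s.Nonempty ∧ ∀ v ∈ s, (v.1, !v.2) ∉ s := by
  have hneg : ∀ v : Fin n × Bool, vertex n (v.1, !v.2) = -vertex n v := by
    rintro ⟨i, b⟩
    ext j
    cases b <;> by_cases h : j = i <;> simp [vertex, h]
  have hmem : ∀ v, vertex n v ∈ polytope n := fun v => subset_convexHull ℝ _ ⟨v, rfl⟩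
  constructor
  · rintro ⟨hs, hexp, hne⟩
    refine ⟨hs, fun v hv hv' => hne ?_⟩
    obtain ⟨l, hl⟩ := hexp (hs.to_set.image (vertex n)).convexHull
    have h1 : vertex n v ∈ convexHull ℝ (vertex n '' s) := subset_convexHull ℝ _ ⟨v, hv, rfl⟩
    have h2 : vertex n (v.1, !v.2) ∈ convexHull ℝ (vertex n '' s) :=
      subset_convexHull ℝ _ ⟨_, hv', rfl⟩
    rw [hneg] at h2
    rw [hl] at h1 h2
    have hle : ∀ y ∈ polytope n, l y ≤ 0 := by
      intro y hy
      have a := h1.2 y hy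
      have b := h2.2 y hy
      rw [map_neg] at b
      linarith
    have hge : ∀ y ∈ polytope n, 0 ≤ l y := by
      intro y hy
      have hsub : polytope n ⊆ {x | 0 ≤ l x} := by
        refine convexHull_min ?_ (convex_halfSpace_ge l.toLinearMap.isLinear 0)
        rintro _ ⟨w, rfl⟩
        have := hle _ (hmem (w.1, !w.2))
        rw [hneg, map_neg] at this
        simpa using this
      exact hsub hy
    rw [hl]
    ext x
    exact ⟨fun h => h.1, fun h => ⟨h, fun y hy => (hle y hy).trans (hge x h)⟩⟩
  · rintro ⟨hs, hanti⟩
    let c : Fin n × Bool → ℝ := fun v => if v.2 then 1 else -1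
    let l : EuclideanSpace ℝ (Fin n) →L[ℝ] ℝ := ∑ v ∈ s, c v • EuclideanSpace.proj v.1
    have hlv : ∀ w, l (vertex n w) = ∑ v ∈ s, if v.1 = w.1 then c v * c w else 0 := by
      intro w
      simp only [l, sum_apply, smul_apply]
      refine Finset.sum_congr rfl fun v _ => ?_
      by_cases h : v.1 = w.1 <;> simp [vertex, c, h]
    have hin : ∀ w ∈ s, l (vertex n w) = 1 := by
      intro w hw
      rw [hlv, Finset.sum_eq_single w]
      · rcases w with ⟨i, b⟩; cases b <;> simp [c]
      · intro v hv hvw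
        rw [if_neg]
        intro h
        apply hanti w hw
        have : v = (w.1, !w.2) := by
          refine Prod.ext h ?_
          have : v.2 ≠ w.2 := fun h2 => hvw (Prod.ext h h2)
          revert this
          cases v.2 <;> cases w.2 <;> simp
        exact this ▸ hv
      · exact fun h => absurd hw h
    have hout : ∀ w, w ∉ s → l (vertex n w) ≤ 0 := by
      intro w hw
      rw [hlv]
      refine Finset.sum_nonpos fun v hv => ?_
      split_ifs with h
      · have : v.2 ≠ w.2 := fun h2 => hw ((Prod.ext h h2 : v = w) ▸ hv)
        revert this
        simp only [c]
        cases v.2 <;> cases w.2 <;> simp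
      · exact le_rfl
    have hle : ∀ y ∈ polytope n, l y ≤ 1 := by
      intro y hy
      have hsub : polytope n ⊆ {x | l x ≤ 1} := by
        refine convexHull_min ?_ (convex_halfSpace_le l.toLinearMap.isLinear 1)
        rintro _ ⟨w, rfl⟩
        by_cases hw : w ∈ s
        · exact (hin w hw).le
        · exact (hout w hw).trans zero_le_one
      exact hsub hy
    have hsubP : convexHull ℝ (vertex n '' s) ⊆ polytope n :=
      convexHull_mono (Set.image_subset_range _ _)
    have hone : ∀ x ∈ convexHull ℝ (vertex n '' s), l x = 1 := by
      intro x hx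
      have hsub : convexHull ℝ (vertex n '' s) ⊆ {x | l x = 1} := by
        refine convexHull_min ?_ (convex_hyperplane l.toLinearMap.isLinear 1)
        rintro _ ⟨w, hw, rfl⟩
        exact hin w hw
      exact hsub hx
    refine ⟨hs, fun _ => ⟨l, ?_⟩, ?_⟩
    · ext x
      constructor
      · intro hx
        exact ⟨hsubP hx, fun y hy => (hle y hy).trans (hone x hx).ge⟩
      · rintro ⟨hx, hmax⟩
        obtain ⟨w₀, hw₀⟩ := hs
        have h1 : l x = 1 := le_antisymm (hle x hx) (hin w₀ hw₀ ▸ hmax _ (hmem w₀))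
        have hx' := hx
        rw [polytope, convexHull_range_eq_exists_affineCombination] at hx'
        obtain ⟨t, a, ha0, ha1, rfl⟩ := hx'
        rw [Finset.affineCombination_eq_linear_combination _ _ _ ha1] at h1 ⊢
        have hz : ∀ v ∈ t, v ∉ s → a v = 0 := by
          by_contra! hcon
          obtain ⟨v, hvt, hvs, hav⟩ := hcon
          rw [map_sum] at h1
          have : ∑ i ∈ t, l (a i • vertex n i) < ∑ i ∈ t, a i := by
            refine Finset.sum_lt_sum (fun i hi => ?_) ⟨v, hvt, ?_⟩
            · have := hle _ (hmem i)
              rw [map_smul, smul_eq_mul]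
              nlinarith [ha0 i hi]
            · have := hout v hvs
              have hpos : 0 < a v := lt_of_le_of_ne (ha0 v hvt) (Ne.symm hav)
              rw [map_smul, smul_eq_mul]
              nlinarith
          linarith
        have e1 : ∑ i ∈ t with i ∈ s, a i = 1 := by
          rw [← ha1]
          refine Finset.sum_subset (Finset.filter_subset _ _) fun i hi hi' => ?_
          exact hz i hi fun h => hi' (Finset.mem_filter.2 ⟨hi, h⟩)
        have e2 : ∑ i ∈ t with i ∈ s, a i • vertex n i = ∑ i ∈ t, a i • vertex n i := by
          refine Finset.sum_subset (Finset.filter_subset _ _) fun i hi hi' => ?_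
          rw [hz i hi fun h => hi' (Finset.mem_filter.2 ⟨hi, h⟩), zero_smul]
        rw [← e2]
        refine (convex_convexHull ℝ _).sum_mem
          (fun i hi => ha0 i (Finset.mem_filter.1 hi).1) e1 fun i hi => ?_
        exact subset_convexHull ℝ _ ⟨i, (Finset.mem_filter.1 hi).2, rfl⟩
    · intro heq
      obtain ⟨w, hw⟩ := hs
      have h := hone (vertex n (w.1, !w.2)) (heq ▸ hmem _)
      rw [hneg, map_neg, hin w hw] at h
      norm_num at h

/-- The boundary complex of the `n`-dimensional cross polytope, on the vertex set
`Fin n × Bool`, where `(i, true)` is `e_i` and `(i, false)` is `-e_i`. -/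
def boundaryComplex (n : ℕ) : PreAbstractSimplicialComplex (Fin n × Bool) where
  faces := {s | SpansProperFace n s}
  isRelLowerSet_faces := by
    intro s hs
    refine ⟨hs.1, fun t hts ht => ?_⟩
    have h := ((spansProperFace_iff n s).1 hs).2
    exact (spansProperFace_iff n t).2 ⟨ht, fun v hv hv' => h v (hts hv) (hts hv')⟩

end CrossPolytope

/-!
Take the words of eight signs in which consecutive letters differ at most twice. They are facets of
the boundary of the cross polytope and generate a complex `tube`; the faces that it shares with the
complex of the remaining words form the complex `tubeBoundary`, which is the required `M`.

*Topology.* Points of the boundary of the cross polytope are rays in the space of vectors with eight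
coordinates (`RaySphere`), and `nonempty_homeomorph_realization` identifies `|M|` with the rays of
vectors that have a sign word with at most two switches and another one with more, the freedom being
the choice of signs for zero entries. That is, `|M|` is `lowSet \ lowInterior`. The flow generated
by a tridiagonal matrix with positive entries next to the diagonal diminishes the number of sign
changes: it is a limit of products of operators `1 + h • E`, where `E` is a matrix unit next to the
diagonal (`tendsto_pow_sub_pow`), each of which moves an entry towards the sign of its neighbour. At
positive times it even maps `lowSet` into `lowInterior`
(`IsTridiagFlow.mem_lowInterior_of_mem_lowSet`), so on rays `lowSet` is a trapping region with cross
section `|M|`.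

For the matrix of `f ↦ (n - 1) x f + (1 - x ^ 2) f'`, the eigenvectors are the coefficient vectors
of `(1 + x) ^ (n - 1 - j) * (1 - x) ^ j`, and the `j`-th has exactly `j` sign changes. With `n = 8`
the region where the squared length of the components `j = 0, 1, 2` is at least that of the other
five is another trapping region of the same flow (`isAdapted_modelForm`), and its cross section is
plainly the product of a 4-sphere and a 2-sphere. Each orbit of a ray converges to an eigenvector,
and the two regions contain the same eigenvectors; by compactness each region flows into the other
(`IsAdapted.exists_time`). Regions of that kind are homeomorphic, and so are their cross sections
(`Flow.IsTrapping.nonempty_homeomorph`, `Flow.IsTrapping.nonempty_homeomorph_section`).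

*Links.* Rotating the letters cyclically or reversing all of them preserves the bound by two
switches (`switches_rotate`), so that the link of a vertex in `tube` is the complex of the words of
seven letters with at most two switches after a leading `true`. The same comparison of trapping
regions, for `n = 7` and with an eigenvector on the threshold itself, shows that it is a ball
(`triangulates_link_tube`). Its boundary is the link in `M` (`boundary_link_tube`), because two
words that share a face, one with at most two switches and one with more, are joined by words that
share it too and differ by one letter at a time (`exists_boundary_word`).

*Faces.* A partial word with `m` prescribed letters, `m > 0`, can be completed with fewer than `m`
switches, and with more than `7 - m`: a free letter repeats its neighbour or differs from it. Hence
all faces with at most three vertices lie in `M`, all faces of `tube` with at most five vertices lie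
in `M`, and the faces of `M` are counted by following the completions with the fewest and the most
switches (`minSwitches`, `maxSwitches`).
-/

section

open Set Topology Filter

/-! ### Trapping regions of a flow -/

/-- A trapping region of a flow: a closed set `K` with an open subset `O` such that every point
of `K` lies in `O` at all later times. The difference `K \ O` is then a cross section of the
flow. -/
structure Flow.IsTrapping {X : Type*} [TopologicalSpace X] (φ : Flow ℝ X) (K O : Set X) :
    Prop where
  isClosed : IsClosed K
  isOpen : IsOpen O
  subset : O ⊆ K
  mem_of_pos : ∀ t > 0, ∀ x ∈ K, φ t x ∈ O

namespace Flow

variable {X : Type*} [TopologicalSpace X] (φ : Flow ℝ X) {K O K' O' : Set X}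

/-- The time at which the orbit of `x` enters `K`, truncated to the interval `[-N, N]`. -/
noncomputable def entryTime (K : Set X) (N : ℝ) (x : X) : ℝ :=
  sInf {t | t ∈ Icc (-N) N ∧ (t = N ∨ φ t x ∈ K)}

theorem continuous_time (x : X) : Continuous fun t => φ t x :=
  φ.continuous continuous_id continuous_const

theorem map_neg_map (t : ℝ) (x : X) : φ (-t) (φ t x) = x := by
  rw [← φ.map_add, neg_add_cancel, φ.map_zero_apply]

variable {φ}

namespace IsTrapping

theorem mem_of_nonneg (h : φ.IsTrapping K O) {t : ℝ} (ht : 0 ≤ t) {x : X} (hx : x ∈ K) :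
    φ t x ∈ K := by
  rcases ht.eq_or_lt with rfl | ht
  · rwa [φ.map_zero_apply]
  · exact h.subset (h.mem_of_pos t ht x hx)

theorem mem_mono (h : φ.IsTrapping K O) {s t : ℝ} (hst : s ≤ t) {x : X} (hx : φ s x ∈ K) :
    φ t x ∈ K := by
  have := h.mem_of_nonneg (sub_nonneg.2 hst) hx
  rwa [← φ.map_add, sub_add_cancel] at this

theorem mem_of_lt (h : φ.IsTrapping K O) {s t : ℝ} (hst : s < t) {x : X} (hx : φ s x ∈ K) :
    φ t x ∈ O := by
  have := h.mem_of_pos _ (sub_pos.2 hst) _ hx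
  rwa [← φ.map_add, sub_add_cancel] at this

variable {N : ℝ}

theorem entryTime_mem (h : φ.IsTrapping K O) (hN : 0 ≤ N) (x : X) :
    φ.entryTime K N x ∈ Icc (-N) N ∧
      (φ.entryTime K N x = N ∨ φ (φ.entryTime K N x) x ∈ K) := by
  refine IsClosed.csInf_mem (s := {t | t ∈ Icc (-N) N ∧ (t = N ∨ φ t x ∈ K)}) ?_ ?_ ?_
  rotate_left
  · exact ⟨N, ⟨by linarith, le_rfl⟩, Or.inl rfl⟩
  · exact ⟨-N, fun t ht => ht.1.1⟩
  · exact isClosed_Icc.inter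
      (isClosed_singleton.union (h.isClosed.preimage (φ.continuous_time x)))

theorem entryTime_le_iff (h : φ.IsTrapping K O) {a : ℝ} (ha : -N ≤ a) (ha' : a < N) (x : X) :
    φ.entryTime K N x ≤ a ↔ φ a x ∈ K := by
  constructor
  · intro hle
    rcases (h.entryTime_mem (N := N) (by linarith) x).2 with h1 | h1
    · linarith
    · exact h.mem_mono hle h1
  · intro hx
    exact csInf_le ⟨-N, fun t ht => ht.1.1⟩ ⟨⟨ha, ha'.le⟩, Or.inr hx⟩

theorem entryTime_lt_iff (h : φ.IsTrapping K O) {a : ℝ} (ha : -N < a) (ha' : a ≤ N) (x : X) :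
    φ.entryTime K N x < a ↔ φ a x ∈ O := by
  constructor
  · intro hlt
    rcases (h.entryTime_mem (N := N) (by linarith) x).2 with h1 | h1
    · linarith
    · exact h.mem_of_lt hlt h1
  · intro hx
    -- openness of `O` lets the orbit be followed a little further back
    have h1 : ∀ᶠ t in 𝓝[<] a, φ t x ∈ O :=
      nhdsWithin_le_nhds ((φ.continuous_time x).continuousAt.eventually_mem (h.isOpen.mem_nhds hx))
    have h2 : ∀ᶠ t in 𝓝[<] a, t ∈ Ioo (-N) a := Ioo_mem_nhdsLT ha
    obtain ⟨t, ht, ht'⟩ := (h1.and h2).exists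
    exact ((h.entryTime_le_iff ht'.1.le (by linarith [ht'.2]) x).2 (h.subset ht)).trans_lt ht'.2

theorem continuous_entryTime (h : φ.IsTrapping K O) (hN : 0 ≤ N) :
    Continuous (φ.entryTime K N) := by
  have hc : ∀ t, Continuous (φ t) := fun t => φ.continuous continuous_const continuous_id
  rw [OrderTopology.continuous_iff]
  intro a
  constructor
  · rcases lt_or_ge a (-N) with h1 | h1
    · convert isOpen_univ
      ext x
      simpa using h1.trans_le (h.entryTime_mem hN x).1.1
    rcases lt_or_ge a N with h2 | h2
    · convert (h.isClosed.preimage (hc a)).isOpen_compl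
      ext x
      simp [← h.entryTime_le_iff h1 h2]
    · convert isOpen_empty
      ext x
      simpa using (h.entryTime_mem hN x).1.2.trans h2
  · rcases le_or_gt a (-N) with h1 | h1
    · convert isOpen_empty
      ext x
      simpa using h1.trans (h.entryTime_mem hN x).1.1
    rcases le_or_gt a N with h2 | h2
    · convert h.isOpen.preimage (hc a)
      ext x
      simp [← h.entryTime_lt_iff h1 h2]
    · convert isOpen_univ
      ext x
      simpa using (h.entryTime_mem hN x).1.2.trans_lt h2

/-- As long as the truncation is not felt, flowing for time `r` lowers the entry time by `r`. -/
theorem entryTime_map (h : φ.IsTrapping K O) {x : X} {r : ℝ}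
    (h1 : -N < φ.entryTime K N x) (h2 : φ.entryTime K N x < N)
    (h3 : -N < φ.entryTime K N x - r) (h4 : φ.entryTime K N x - r < N) :
    φ.entryTime K N (φ r x) = φ.entryTime K N x - r := by
  have hN : 0 ≤ N := by linarith
  apply le_antisymm
  · rw [h.entryTime_le_iff h3.le h4, ← φ.map_add, sub_add_cancel,
      ← h.entryTime_le_iff (N := N) h1.le h2]
  · by_contra! hlt
    rw [h.entryTime_lt_iff h3 h4.le, ← φ.map_add, sub_add_cancel,
      ← h.entryTime_lt_iff (N := N) h1 h2.le] at hlt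
    exact lt_irrefl _ hlt

theorem entryTime_eq_zero_iff (h : φ.IsTrapping K O) (hN : 0 < N) (x : X) :
    φ.entryTime K N x = 0 ↔ x ∈ K \ O := by
  have h1 := h.entryTime_le_iff (N := N) (a := 0) (by linarith) hN x
  have h2 := h.entryTime_lt_iff (N := N) (a := 0) (by linarith) hN.le x
  rw [φ.map_zero_apply] at h1 h2
  rw [Set.mem_sdiff, ← h1, ← h2, not_lt, le_antisymm_iff]

theorem entryTime_nonpos_iff (h : φ.IsTrapping K O) (hN : 0 < N) (x : X) :
    φ.entryTime K N x ≤ 0 ↔ x ∈ K := by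
  rw [h.entryTime_le_iff (by linarith) hN, φ.map_zero_apply]

/-- If `K` flows into `K'` within time `T`, then the entry times compare accordingly. -/
theorem entryTime_le_add (h : φ.IsTrapping K O) (h' : φ.IsTrapping K' O') {T : ℝ}
    (hK : ∀ x ∈ K, φ T x ∈ K') (hN : 0 ≤ N) {x : X}
    (h1 : -N ≤ φ.entryTime K N x + T) (h2 : φ.entryTime K N x + T < N) (hT : 0 ≤ T) :
    φ.entryTime K' N x ≤ φ.entryTime K N x + T := by
  rw [h'.entryTime_le_iff h1 h2, add_comm, φ.map_add]
  apply hK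
  rcases (h.entryTime_mem hN x).2 with h3 | h3
  · linarith
  · exact h3

/-- Two trapping regions that flow into each other have homeomorphic cross sections. -/
theorem nonempty_homeomorph_section (h : φ.IsTrapping K O) (h' : φ.IsTrapping K' O') {T : ℝ}
    (hT : 0 < T) (hK : ∀ x ∈ K, φ T x ∈ K') (hK' : ∀ x ∈ K', φ T x ∈ K) :
    Nonempty ((K \ O : Set X) ≃ₜ (K' \ O' : Set X)) := by
  -- the truncation level is so large that it is not felt by the times below
  obtain ⟨N, hNT⟩ : ∃ N, N = 3 * T := ⟨_, rfl⟩
  have hN : 0 < N := by linarith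
  have key : ∀ {K O K' O' : Set X} (_ : φ.IsTrapping K O) (_ : φ.IsTrapping K' O')
      (_ : ∀ x ∈ K, φ T x ∈ K') (_ : ∀ x ∈ K', φ T x ∈ K) (x : X), x ∈ K \ O →
      φ (φ.entryTime K' N x) x ∈ K' \ O' ∧
      φ.entryTime K N (φ (φ.entryTime K' N x) x) = - φ.entryTime K' N x := by
    intro K O K' O' h h' hK hK' x hx
    have h0 := (h.entryTime_eq_zero_iff hN x).2 hx
    have h1 := h.entryTime_le_add h' (N := N) hK hN.le (x := x) (by linarith) (by linarith) hT.le
    have h2 := (h'.entryTime_mem hN.le x).1.1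
    have h3 := h'.entryTime_le_add h (N := N) hK' hN.le (x := x) (by linarith) (by linarith) hT.le
    constructor
    · rw [← h'.entryTime_eq_zero_iff hN, h'.entryTime_map] <;> linarith
    · rw [h.entryTime_map] <;> linarith
  have cont : ∀ {K O K' O' : Set X} (_ : φ.IsTrapping K' O'),
      Continuous fun x : (K \ O : Set X) => φ (φ.entryTime K' N x) (x : X) := fun h' =>
    φ.continuous ((h'.continuous_entryTime hN.le).comp continuous_subtype_val)
      continuous_subtype_val
  exact ⟨{
    toFun := fun x => ⟨_, (key h h' hK hK' x x.2).1⟩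
    invFun := fun x => ⟨_, (key h' h hK' hK x x.2).1⟩
    left_inv := fun x => by
      ext
      simp only
      rw [(key h h' hK hK' x x.2).2, φ.map_neg_map]
    right_inv := fun x => by
      ext
      simp only
      rw [(key h' h hK' hK x x.2).2, φ.map_neg_map]
    continuous_toFun := (cont h').subtype_mk _
    continuous_invFun := (cont h).subtype_mk _ }⟩

/-- Two trapping regions that flow into each other are homeomorphic. Along each orbit that crosses
the cross sections, the time interval after the entry into `K` is stretched onto the one after the
entry into `K'`; the stretching is the identity from time `2 * T` after the entry on, so that it
extends continuously by the identity to the orbits that never leave the regions. -/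
theorem nonempty_homeomorph [CompactSpace X] [T2Space X] (h : φ.IsTrapping K O)
    (h' : φ.IsTrapping K' O') {T : ℝ}
    (hT : 0 < T) (hK : ∀ x ∈ K, φ T x ∈ K') (hK' : ∀ x ∈ K', φ T x ∈ K) :
    Nonempty (K ≃ₜ K') := by
  -- the truncation level is so large that it is not felt by the times below
  obtain ⟨N, hNT⟩ : ∃ N, N = 7 * T := ⟨_, rfl⟩
  have hN : 0 < N := by linarith
  obtain ⟨e, he⟩ : ∃ e, e = φ.entryTime K N := ⟨_, rfl⟩
  obtain ⟨e', he'⟩ : ∃ e', e' = φ.entryTime K' N := ⟨_, rfl⟩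
  have ec : Continuous e := he ▸ h.continuous_entryTime hN.le
  have ec' : Continuous e' := he' ▸ h'.continuous_entryTime hN.le
  have eK : ∀ x, e x ≤ 0 ↔ x ∈ K := fun x => he ▸ h.entryTime_nonpos_iff hN x
  have eK' : ∀ x, e' x ≤ 0 ↔ x ∈ K' := fun x => he' ▸ h'.entryTime_nonpos_iff hN x
  have emap : ∀ {x r}, -N < e x → e x < N → -N < e x - r → e x - r < N →
      e (φ r x) = e x - r := by
    subst he
    exact fun h1 h2 h3 h4 => h.entryTime_map h1 h2 h3 h4
  have emap' : ∀ {x r}, -N < e' x → e' x < N → -N < e' x - r → e' x - r < N →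
      e' (φ r x) = e' x - r := by
    subst he'
    exact fun h1 h2 h3 h4 => h'.entryTime_map h1 h2 h3 h4
  have elow : ∀ x, -N ≤ e x := fun x => he ▸ (h.entryTime_mem hN.le x).1.1
  have elow' : ∀ x, -N ≤ e' x := fun x => he' ▸ (h'.entryTime_mem hN.le x).1.1
  have ecmp : ∀ x, e x + T < N → e' x ≤ e x + T := fun x hx => by
    have := elow x
    subst he he'
    exact h.entryTime_le_add h' hK hN.le (by linarith) hx hT.le
  have ecmp' : ∀ x, e' x + T < N → e x ≤ e' x + T := fun x hx => by
    have := elow' x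
    subst he he'
    exact h'.entryTime_le_add h hK' hN.le (by linarith) hx hT.le
  -- on the range of times used below, the two entry times differ by at most `T`
  have near : ∀ x, -2 * T ≤ e x → e x ≤ T → |e' x - e x| ≤ T := fun x h1 h2 => by
    have h3 := ecmp x (by linarith)
    have h4 := ecmp' x (by linarith)
    rw [abs_le]
    constructor <;> linarith
  obtain ⟨m, hm⟩ : ∃ m : X → ℝ, m = fun x => max 0 (1 + e x / (2 * T)) := ⟨_, rfl⟩
  obtain ⟨s, hs⟩ : ∃ s : X → ℝ, s = fun x => (e' x - e x) * m x := ⟨_, rfl⟩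
  have mc : Continuous m := by rw [hm]; fun_prop
  have sc : Continuous s := by rw [hs]; fun_prop
  have m_zero : ∀ x, e x ≤ -2 * T → m x = 0 := fun x hx => by
    rw [hm]
    refine max_eq_left ?_
    have : e x / (2 * T) ≤ -1 := by rw [div_le_iff₀ (by linarith)]; linarith
    linarith
  have s_zero : ∀ x, e x ≤ -2 * T → s x = 0 := fun x hx => by rw [hs]; simp [m_zero x hx]
  have m_eq : ∀ x, -2 * T ≤ e x → m x * (2 * T) = 2 * T + e x := fun x hx => by
    rw [hm]
    have : -1 ≤ e x / (2 * T) := by rw [le_div_iff₀ (by linarith)]; linarith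
    simp only
    rw [max_eq_right (by linarith)]
    field_simp
  have m_nonneg : ∀ x, 0 ≤ m x := fun x => by rw [hm]; exact le_max_left _ _
  have s_abs : ∀ x, -2 * T ≤ e x → e x ≤ 0 → |s x| ≤ T := fun x h1 h2 => by
    have h3 := near x h1 (by linarith)
    have h4 := m_eq x h1
    have h5 : m x ≤ 1 := by nlinarith
    rw [hs]
    simp only
    rw [abs_mul, abs_of_nonneg (m_nonneg x)]
    nlinarith [abs_nonneg (e' x - e x), m_nonneg x]
  have maps : ∀ x ∈ K, φ (s x) x ∈ K' := fun x hx => by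
    rcases le_total (e x) (-2 * T) with h1 | h1
    · rw [s_zero x h1, φ.map_zero_apply]
      have h2 : φ (-2 * T) x ∈ K := by
        rwa [he, h.entryTime_le_iff (by linarith) (by linarith)] at h1
      have h3 := h'.mem_of_nonneg hT.le (hK _ h2)
      rwa [← φ.map_add, ← φ.map_add, show T + T + -2 * T = 0 by ring,
        φ.map_zero_apply] at h3
    · have h2 := (eK x).2 hx
      have h3 := abs_le.1 (near x h1 (by linarith))
      have h4 := abs_le.1 (s_abs x h1 h2)
      have h5 := m_eq x h1
      rw [← eK', emap' (by linarith) (by linarith) (by linarith) (by linarith)]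
      have h6 : (e' x - s x) * (2 * T) = e x * (2 * T - (e' x - e x)) := by
        rw [hs]
        linear_combination (-(e' x - e x)) * h5
      nlinarith
  let f : K → K' := fun x => ⟨φ (s x) x, maps x x.2⟩
  have fc : Continuous f :=
    (φ.continuous (sc.comp continuous_subtype_val) continuous_subtype_val).subtype_mk _
  have inj_aux : ∀ x ∈ K, ∀ y ∈ K, φ (s x) x = φ (s y) y → ¬ 0 < s x - s y := by
    intro x hx y hy hxy hr
    have hy' : y = φ (s x - s y) x := by
      rw [sub_eq_neg_add, φ.map_add, hxy, φ.map_neg_map]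
    have ex := (eK x).2 hx
    have ey := (eK y).2 hy
    rcases le_total (e x) (-2 * T) with h1 | h1
    · have h2 : φ (-2 * T) x ∈ K := by
        rwa [he, h.entryTime_le_iff (by linarith) (by linarith)] at h1
      have h3 := h.mem_of_nonneg hr.le h2
      rw [← φ.map_add, add_comm, φ.map_add, ← hy'] at h3
      have h4 : e y ≤ -2 * T := by
        rwa [he, h.entryTime_le_iff (by linarith) (by linarith)]
      rw [s_zero x h1, s_zero y h4] at hr
      linarith
    · have h2 := abs_le.1 (s_abs x h1 ex)
      have h3 : |s y| ≤ T := by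
        rcases le_total (e y) (-2 * T) with h4 | h4
        · rw [s_zero y h4, abs_zero]
          exact hT.le
        · exact s_abs y h4 ey
      have h4 := abs_le.1 h3
      have h5 := abs_le.1 (near x h1 (by linarith))
      have h6 : e y = e x - (s x - s y) := by
        conv_lhs => rw [hy']
        exact emap (by linarith) (by linarith) (by linarith) (by linarith)
      have h7 : e' y = e' x - (s x - s y) := by
        conv_lhs => rw [hy']
        exact emap' (by linarith) (by linarith) (by linarith) (by linarith)
      have h8 : s x - s y = (e' x - e x) * (m x - m y) := by
        have h9 : s y = (e' x - e x) * m y := by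
          rw [hs]
          simp only
          rw [h7, h6]
          ring
        rw [h9, hs]
        ring
      -- the weight `m` has slope `1 / (2 * T)`, so the shift cannot catch up with the flow
      have h9 : (m x - m y) * (2 * T) ≤ s x - s y := by
        have h10 := m_eq x h1
        rcases le_total (e y) (-2 * T) with h11 | h11
        · have := m_zero y h11
          nlinarith
        · have := m_eq y h11
          linarith
      have h10 : 0 ≤ m x - m y := by
        have h10 := m_eq x h1
        rcases le_total (e y) (-2 * T) with h11 | h11
        · rw [m_zero y h11, sub_zero]
          exact m_nonneg x
        · have := m_eq y h11
          nlinarith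
      nlinarith
  have inj : Function.Injective f := by
    intro x y hxy
    have hxy' : φ (s x) (x : X) = φ (s y) (y : X) := congrArg Subtype.val hxy
    have h1 := inj_aux x x.2 y y.2 hxy'
    have h2 := inj_aux y y.2 x x.2 hxy'.symm
    have h3 : s x = s y := by linarith
    rw [h3] at hxy'
    ext
    rw [← φ.map_neg_map (s y) (x : X), hxy', φ.map_neg_map]
  have surj : Function.Surjective f := by
    rintro ⟨z, hz⟩
    have ez' := (eK' z).2 hz
    have h0 := ecmp' z (by linarith)
    rcases le_total (e z) (-2 * T) with h1 | h1
    · refine ⟨⟨z, (eK z).1 (by linarith)⟩, ?_⟩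
      ext
      simp only [f]
      rw [s_zero z h1, φ.map_zero_apply]
    · have gc : Continuous fun r => r + s (φ r z) :=
        continuous_id.add (sc.comp (φ.continuous_time z))
      have h2 : e z + s (φ (e z) z) ≤ 0 := by
        have h3 := abs_le.1 (near z h1 (by linarith))
        have h4 : e (φ (e z) z) = e z - e z :=
          emap (by linarith) (by linarith) (by linarith) (by linarith)
        have h5 : e' (φ (e z) z) = e' z - e z :=
          emap' (by linarith) (by linarith) (by linarith) (by linarith)
        have h6 : m (φ (e z) z) = 1 := by
          rw [hm]
          simp [h4]
        have h7 : s (φ (e z) z) = e' z - e z := by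
          rw [hs]
          simp only
          rw [h4, h5, h6]
          ring
        linarith
      have h3 : 0 ≤ 4 * T + s (φ (4 * T) z) := by
        rw [s_zero]
        · linarith
        · rw [emap (by linarith) (by linarith) (by linarith) (by linarith)]
          linarith
      obtain ⟨r, hr, hr'⟩ := intermediate_value_Icc (by linarith : e z ≤ 4 * T)
        gc.continuousOn ⟨h2, h3⟩
      have h4 : φ (e z) z ∈ K := by
        rw [← h.entryTime_le_iff (N := N) (by linarith) (by linarith), ← he]
      refine ⟨⟨φ r z, h.mem_mono hr.1 h4⟩, ?_⟩
      ext
      simp only [f]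
      rw [← φ.map_add, add_comm]
      simp only at hr'
      rw [hr', φ.map_zero_apply]
  have : CompactSpace K := isCompact_iff_compactSpace.1 h.isClosed.isCompact
  exact ⟨fc.homeoOfEquivCompactToT2 (f := Equiv.ofBijective f ⟨inj, surj⟩)⟩

/-- If all points of `K` eventually flow into `O'`, then they do so within a common time, and may
stay there for any longer time. -/
theorem exists_forall_mem [CompactSpace X] (h : φ.IsTrapping K O) (h' : φ.IsTrapping K' O')
    (hev : ∀ x ∈ K, ∃ t, φ t x ∈ O') : ∃ T₀, ∀ T, T₀ ≤ T → ∀ x ∈ K, φ T x ∈ K' := by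
  obtain ⟨T, hT⟩ := h.isClosed.isCompact.elim_directed_cover (fun t : ℝ => φ t ⁻¹' O')
    (fun t => h'.isOpen.preimage (φ.continuous continuous_const continuous_id))
    (fun x hx => mem_iUnion.2 (hev x hx)) (by
      refine Monotone.directed_le fun s t hst x hx => ?_
      rcases hst.eq_or_lt with rfl | hst
      · exact hx
      · exact h'.mem_of_lt hst (h'.subset hx))
  exact ⟨T, fun T' hT' x hx => h'.mem_mono hT' (h'.subset (hT hx))⟩

end IsTrapping

end Flow

/-! ### Products of nearly equal operators -/

section Trotter

theorem norm_pow_sub_pow_le {𝔸 : Type*} [NormedRing 𝔸] [NormOneClass 𝔸] {x y : 𝔸} {M : ℝ}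
    (hM : 1 ≤ M) (hx : ‖x‖ ≤ M) (hy : ‖y‖ ≤ M) (k : ℕ) : ‖x ^ k - y ^ k‖ ≤ k * M ^ k * ‖x - y‖ := by
  induction k with
  | zero => simp
  | succ k ih =>
    have h1 : x ^ (k + 1) - y ^ (k + 1) = x ^ k * (x - y) + (x ^ k - y ^ k) * y := by
      rw [pow_succ, pow_succ]
      noncomm_ring
    have h2 : ‖x ^ k‖ ≤ M ^ k := (norm_pow_le x k).trans (pow_le_pow_left₀ (norm_nonneg _) hx k)
    have hM0 : 0 ≤ M := zero_le_one.trans hM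
    calc ‖x ^ (k + 1) - y ^ (k + 1)‖ ≤ ‖x ^ k‖ * ‖x - y‖ + ‖x ^ k - y ^ k‖ * ‖y‖ := by
          rw [h1]
          exact (norm_add_le _ _).trans (add_le_add (norm_mul_le _ _) (norm_mul_le _ _))
      _ ≤ M ^ k * M * ‖x - y‖ + k * M ^ k * ‖x - y‖ * M := by
          gcongr
          exact h2.trans (le_mul_of_one_le_right (by positivity) hM)
      _ = (k + 1 : ℕ) * M ^ (k + 1) * ‖x - y‖ := by
          push_cast
          ring

variable {𝔸 : Type*} [NormedRing 𝔸] [NormOneClass 𝔸] [NormedAlgebra ℝ 𝔸]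

theorem HasDerivAt.exists_norm_le_exp {S : ℝ → 𝔸} {A : 𝔸} (h0 : S 0 = 1)
    (hS : HasDerivAt S A 0) : ∃ C, ∀ᶠ h in 𝓝 0, ‖S h‖ ≤ Real.exp (C * |h|) := by
  obtain ⟨C, hC⟩ := hS.isBigO_sub.bound
  refine ⟨C, hC.mono fun h hh => ?_⟩
  rw [h0, sub_zero, Real.norm_eq_abs] at hh
  calc ‖S h‖ = ‖1 + (S h - 1)‖ := by rw [add_sub_cancel]
    _ ≤ 1 + C * |h| := (norm_add_le _ _).trans (by rw [norm_one]; gcongr)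
    _ ≤ Real.exp (C * |h|) := by rw [add_comm]; exact Real.add_one_le_exp _

/-- Two curves through `1` with the same derivative there have the same limit of powers; for a
one-parameter group this is the product formula of Lie and Trotter. -/
theorem tendsto_pow_sub_pow {S T : ℝ → 𝔸} {A : 𝔸} (hS0 : S 0 = 1) (hT0 : T 0 = 1)
    (hS : HasDerivAt S A 0) (hT : HasDerivAt T A 0) (t : ℝ) :
    Tendsto (fun k : ℕ => S (t / k) ^ k - T (t / k) ^ k) atTop (𝓝 0) := by
  obtain ⟨C, hC⟩ := hS.exists_norm_le_exp hS0
  obtain ⟨C', hC'⟩ := hT.exists_norm_le_exp hT0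
  have hlim : Tendsto (fun k : ℕ => t / k) atTop (𝓝 0) := tendsto_const_div_atTop_nhds_zero_nat t
  have hD := (hS.sub hT).isLittleO
  rw [NormedAddGroup.tendsto_nhds_zero]
  intro δ hδ
  obtain ⟨K, hK⟩ : ∃ K, K = max 0 (max C C') := ⟨_, rfl⟩
  have hK0 : 0 ≤ K := hK ▸ le_max_left _ _
  have hKC : C ≤ K := hK ▸ (le_max_left _ _).trans (le_max_right _ _)
  have hKC' : C' ≤ K := hK ▸ (le_max_right _ _).trans (le_max_right _ _)
  obtain ⟨c, hc⟩ : ∃ c, c = δ / (2 * Real.exp (K * |t|) * (|t| + 1)) := ⟨_, rfl⟩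
  have hc0 : 0 < c := by rw [hc]; positivity
  filter_upwards [hlim.eventually hC, hlim.eventually hC',
    hlim.eventually (hD.def hc0), eventually_gt_atTop 0] with k h1 h2 h3 hk
  have hk' : (0 : ℝ) < k := Nat.cast_pos.2 hk
  have habs : |t / k| = |t| / k := by rw [abs_div, Nat.abs_cast]
  simp only [Pi.sub_apply, hS0, hT0, sub_self, smul_zero, sub_zero, Real.norm_eq_abs] at h3
  rw [habs] at h1 h2 h3
  have h4 := norm_pow_sub_pow_le (x := S (t / k)) (y := T (t / k))
    (M := Real.exp (K * (|t| / k))) (Real.one_le_exp (by positivity))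
    (h1.trans (Real.exp_le_exp.2 (by gcongr))) (h2.trans (Real.exp_le_exp.2 (by gcongr))) k
  have h5 : Real.exp (K * (|t| / k)) ^ k = Real.exp (K * |t|) := by
    rw [← Real.exp_nat_mul]
    congr 1
    field_simp
  rw [h5] at h4
  calc ‖S (t / k) ^ k - T (t / k) ^ k‖ ≤ k * Real.exp (K * |t|) * (c * (|t| / k)) :=
        h4.trans (by gcongr)
    _ = δ * (|t| / (|t| + 1)) / 2 := by
        rw [hc]
        field_simp
    _ < δ := by
        have : |t| / (|t| + 1) ≤ 1 := by
          rw [div_le_one (by positivity)]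
          linarith
        nlinarith

end Trotter

/-! ### Sign words and tridiagonal flows -/

namespace SignWord

/-- The sign `1` or `-1` encoded by a Boolean. -/
def sgn (b : Bool) : ℝ := if b then 1 else -1

@[simp] theorem sgn_true : sgn true = 1 := rfl
@[simp] theorem sgn_false : sgn false = -1 := rfl
@[simp] theorem sgn_not (b : Bool) : sgn (!b) = -sgn b := by cases b <;> simp

/-- The vector `y` lies in the closed orthant of the sign word `ε`. -/
def Compat {ι : Type*} (ε : ι → Bool) (y : ι → ℝ) : Prop := ∀ i, 0 ≤ sgn (ε i) * y i

theorem isClosed_compat {ι : Type*} (ε : ι → Bool) : IsClosed {y | Compat ε y} := by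
  simp only [Compat, ofPred_forall]
  exact isClosed_iInter fun i => isClosed_le continuous_const (by fun_prop)

theorem sgn_mul_self (b : Bool) : sgn b * sgn b = 1 := by cases b <;> simp

theorem eq_of_mul_pos {b c : Bool} {r : ℝ} (hr : r ≠ 0) (hb : 0 ≤ sgn b * r)
    (hc : 0 ≤ sgn c * r) : b = c := by
  cases b <;> cases c <;> simp at * <;> exact hr (by linarith)

variable {n : ℕ}

/-- Neighbours in the path on `Fin n`. -/
def Adj (i j : Fin n) : Prop := i.val + 1 = j.val ∨ j.val + 1 = i.val

instance : DecidableRel (Adj (n := n)) := fun _ _ => inferInstanceAs (Decidable (_ ∨ _))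

theorem Adj.ne {i j : Fin n} (h : Adj i j) : i ≠ j := by
  rintro rfl
  rcases h with h | h <;> omega

/-- A count of sign changes along the path: it does not grow when a letter is replaced by the
letter of a neighbour. -/
def IsVariation (κ : (Fin n → Bool) → ℕ) : Prop :=
  ∀ ε i j, Adj i j → κ (Function.update ε i (ε j)) ≤ κ ε

/-- The vectors that can be given a sign word with at most `m` changes by choosing signs for the
zero entries. -/
def lowSet (κ : (Fin n → Bool) → ℕ) (m : ℕ) : Set (Fin n → ℝ) := {y | ∃ ε, Compat ε y ∧ κ ε ≤ m}

/-- The vectors all of whose sign words have at most `m` changes, however signs are chosen for the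
zero entries. -/
def lowInterior (κ : (Fin n → Bool) → ℕ) (m : ℕ) : Set (Fin n → ℝ) :=
  {y | ∀ ε, Compat ε y → κ ε ≤ m}

theorem isClosed_lowSet (κ : (Fin n → Bool) → ℕ) (m : ℕ) : IsClosed (lowSet κ m) := by
  have : lowSet κ m = ⋃ ε ∈ {ε | κ ε ≤ m}, {y | Compat ε y} := by
    ext y
    simp [lowSet, and_comm]
  rw [this]
  exact (toFinite _).isClosed_biUnion fun ε _ => isClosed_compat ε

theorem isOpen_lowInterior (κ : (Fin n → Bool) → ℕ) (m : ℕ) : IsOpen (lowInterior κ m) := by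
  have : lowInterior κ m = (⋃ ε ∈ {ε | m < κ ε}, {y | Compat ε y})ᶜ := by
    ext y
    simp only [lowInterior, mem_ofPred_eq, mem_compl_iff, mem_iUnion, not_exists, exists_prop,
      not_and, ← not_lt]
    exact forall_congr' fun ε => not_imp_not.symm.trans (by simp)
  rw [this]
  exact ((toFinite _).isClosed_biUnion fun ε _ => isClosed_compat ε).isOpen_compl

theorem exists_compat {ι : Type*} (y : ι → ℝ) : ∃ ε, Compat ε y := by
  classical
  refine ⟨fun i => decide (0 ≤ y i), fun i => ?_⟩
  by_cases h : 0 ≤ y i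
  · simp [h]
  · simp [h, (not_le.1 h).le]

theorem lowInterior_subset (κ : (Fin n → Bool) → ℕ) (m : ℕ) : lowInterior κ m ⊆ lowSet κ m :=
  fun y hy => let ⟨ε, hε⟩ := exists_compat y; ⟨ε, hε, hy ε hε⟩

theorem Compat.smul {ι : Type*} {ε : ι → Bool} {y : ι → ℝ} (h : Compat ε y) {r : ℝ}
    (hr : 0 ≤ r) : Compat ε (r • y) := fun i => by
  have := mul_nonneg hr (h i)
  rw [Pi.smul_apply, smul_eq_mul]
  linarith

theorem compat_smul_iff {ι : Type*} {ε : ι → Bool} {y : ι → ℝ} {r : ℝ} (hr : 0 < r) :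
    Compat ε (r • y) ↔ Compat ε y := by
  refine ⟨fun h => ?_, fun h => h.smul hr.le⟩
  have := h.smul (inv_pos.2 hr).le
  rwa [smul_smul, inv_mul_cancel₀ hr.ne', one_smul] at this

theorem smul_mem_lowSet_iff {κ : (Fin n → Bool) → ℕ} {m : ℕ} {r : ℝ} (hr : 0 < r)
    {y : Fin n → ℝ} : r • y ∈ lowSet κ m ↔ y ∈ lowSet κ m := by
  simp only [lowSet, mem_ofPred_eq, compat_smul_iff hr]

theorem smul_mem_lowInterior_iff {κ : (Fin n → Bool) → ℕ} {m : ℕ} {r : ℝ} (hr : 0 < r)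
    {y : Fin n → ℝ} : r • y ∈ lowInterior κ m ↔ y ∈ lowInterior κ m := by
  simp only [lowInterior, mem_ofPred_eq, compat_smul_iff hr]

/-- The matrix unit with its entry in row `i` and column `j`, as an operator. -/
noncomputable def unit (i j : Fin n) : (Fin n → ℝ) →L[ℝ] (Fin n → ℝ) :=
  (ContinuousLinearMap.proj (R := ℝ) (φ := fun _ : Fin n => ℝ) j).smulRight (Pi.single i (1 : ℝ))

theorem elementary_apply (i j : Fin n) (h : ℝ) (y : Fin n → ℝ) :
    (1 + h • unit i j) y = Function.update y i (y i + h * y j) := by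
  ext k
  by_cases hk : k = i
  · subst hk
    simp [unit]
  · simp [unit, hk]

/-- Adding to an entry a nonnegative multiple of its neighbour creates no sign changes. -/
theorem elementary_mem_lowSet {κ : (Fin n → Bool) → ℕ} (hκ : IsVariation κ) {m : ℕ} {i j : Fin n}
    (hij : Adj i j) {h : ℝ} (hh : 0 ≤ h) {y : Fin n → ℝ} (hy : y ∈ lowSet κ m) :
    (1 + h • unit i j) y ∈ lowSet κ m := by
  rw [elementary_apply]
  obtain ⟨ε, hε, hm⟩ := hy
  by_cases hs : 0 ≤ sgn (ε i) * (y i + h * y j)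
  · refine ⟨ε, fun k => ?_, hm⟩
    by_cases hk : k = i
    · subst hk
      simpa using hs
    · simpa [hk] using hε k
  · -- the new entry has the sign of its neighbour, to which the letter is changed
    refine ⟨Function.update ε i (ε j), fun k => ?_, (hκ ε i j hij).trans hm⟩
    by_cases hk : k = i
    · subst hk
      have h1 := hε k
      have h2 := mul_nonneg hh (hε j)
      simp only [Function.update_self]
      have hne : ε j = !ε k := by
        revert h1 h2 hs
        cases ε j <;> cases ε k <;> simp <;> intros <;> linarith
      rw [hne, sgn_not]
      linarith
    · simpa [hk] using hε k

/-- Subtracting from an entry a nonnegative multiple of its neighbour cancels no sign changes. -/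
theorem elementary_not_mem_lowInterior {κ : (Fin n → Bool) → ℕ} (hκ : IsVariation κ) {m : ℕ}
    {i j : Fin n} (hij : Adj i j) {h : ℝ} (hh : 0 ≤ h) {y : Fin n → ℝ}
    (hy : y ∉ lowInterior κ m) : (1 + (-h) • unit i j) y ∉ lowInterior κ m := by
  simp only [lowInterior, mem_ofPred_eq, not_forall, not_le] at hy ⊢
  rw [elementary_apply]
  obtain ⟨ε, hε, hm⟩ := hy
  by_cases hs : 0 ≤ sgn (ε i) * (y i + -h * y j)
  · refine ⟨ε, fun k => ?_, hm⟩
    by_cases hk : k = i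
    · subst hk
      simpa using hs
    · simpa [hk] using hε k
  · -- the new entry has the sign opposite to its neighbour, which only adds changes
    refine ⟨Function.update ε i (!ε j), fun k => ?_, hm.trans_le ?_⟩
    · by_cases hk : k = i
      · subst hk
        have h1 := hε k
        have h2 := mul_nonneg hh (hε j)
        simp only [Function.update_self]
        have hne : ε j = ε k := by
          revert h1 h2 hs
          cases ε j <;> cases ε k <;> simp <;> intros <;> linarith
        rw [hne, sgn_not]
        linarith
      · simpa [hk] using hε k
    · have h1 := hε i
      have h2 := mul_nonneg hh (hε j)
      have hne : ε j = ε i := by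
        revert h1 h2 hs
        cases ε j <;> cases ε i <;> simp <;> intros <;> linarith
      have h3 := hκ (Function.update ε i (!ε j)) i j hij
      have h4 : Function.update (Function.update ε i (!ε j)) i
          (Function.update ε i (!ε j) j) = ε := by
        rw [Function.update_idem, Function.update_of_ne hij.ne.symm, hne,
          Function.update_eq_self]
      rwa [h4] at h3

/-- The operator of a tridiagonal matrix with zero diagonal. -/
noncomputable def tridiag (c : Fin n → Fin n → ℝ) : (Fin n → ℝ) →L[ℝ] (Fin n → ℝ) :=
  ∑ p : Fin n × Fin n with Adj p.1 p.2, c p.1 p.2 • unit p.1 p.2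

theorem tridiag_apply (c : Fin n → Fin n → ℝ) (y : Fin n → ℝ) (i : Fin n) :
    tridiag c y i = ∑ j with Adj i j, c i j * y j := by
  have h1 : tridiag c y i =
      ∑ p : Fin n × Fin n with Adj p.1 p.2,
        (c p.1 p.2 * y p.2) * (Pi.single p.1 (1 : ℝ) : Fin n → ℝ) i := by
    simp [tridiag, unit, mul_assoc]
  rw [h1, Finset.sum_filter, Fintype.sum_prod_type, Finset.sum_filter, Finset.sum_eq_single i]
  · simp
  · intro k _ hk
    simp [Pi.single_eq_of_ne hk.symm]
  · simp

/-- The product of the elementary operators `1 + h c(i, j) E(i, j)` over neighbours `i`, `j`. -/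
noncomputable def elementaryProd (c : Fin n → Fin n → ℝ) (h : ℝ) :
    (Fin n → ℝ) →L[ℝ] (Fin n → ℝ) :=
  ((Finset.univ.filter fun p : Fin n × Fin n => Adj p.1 p.2).toList.map
    fun p => 1 + (h * c p.1 p.2) • unit p.1 p.2).prod

theorem hasDerivAt_list_prod {𝔸 ι : Type*} [NormedRing 𝔸] [NormedAlgebra ℝ 𝔸] (l : List ι)
    (B : ι → 𝔸) (c : ι → ℝ) :
    HasDerivAt (fun h : ℝ => (l.map fun p => 1 + (h * c p) • B p).prod)
      (l.map fun p => c p • B p).sum 0 := by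
  induction l with
  | nil => simpa using hasDerivAt_const (0 : ℝ) (1 : 𝔸)
  | cons p l ih =>
    have h1 : HasDerivAt (fun h : ℝ => 1 + (h * c p) • B p) (c p • B p) 0 := by
      have := (((hasDerivAt_id (0 : ℝ)).mul_const (c p)).smul_const (B p)).const_add 1
      simpa using this
    have h2 := h1.mul ih
    simp only [zero_mul, zero_smul, add_zero, List.map_const', List.prod_replicate, one_pow,
      mul_one, one_mul] at h2
    exact h2

theorem hasDerivAt_elementaryProd (c : Fin n → Fin n → ℝ) :
    HasDerivAt (elementaryProd c) (tridiag c) 0 := by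
  have := hasDerivAt_list_prod
    (Finset.univ.filter fun p : Fin n × Fin n => Adj p.1 p.2).toList
    (fun p => unit p.1 p.2) (fun p => c p.1 p.2)
  rwa [Finset.sum_map_toList] at this

theorem elementaryProd_zero (c : Fin n → Fin n → ℝ) : elementaryProd c 0 = 1 := by
  simp [elementaryProd]

theorem list_prod_mem {E : Type*} [NormedAddCommGroup E] [NormedSpace ℝ E] {P : Set E}
    (l : List (E →L[ℝ] E)) (hl : ∀ L ∈ l, ∀ y ∈ P, L y ∈ P) : ∀ y ∈ P, l.prod y ∈ P := by
  induction l with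
  | nil => simp
  | cons L l ih =>
    intro y hy
    rw [List.prod_cons]
    exact hl L (by simp) _ (ih (fun L' h => hl L' (by simp [h])) y hy)

theorem elementaryProd_mem {c : Fin n → Fin n → ℝ} {h : ℝ} {P : Set (Fin n → ℝ)}
    (hP : ∀ i j, Adj i j → ∀ y ∈ P, (1 + (h * c i j) • unit i j) y ∈ P) (y : Fin n → ℝ)
    (hy : y ∈ P) : elementaryProd c h y ∈ P := by
  refine list_prod_mem _ (fun L hL => ?_) y hy
  simp only [List.mem_map, Finset.mem_toList, Finset.mem_filter, Finset.mem_univ, true_and] at hL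
  obtain ⟨p, hp, rfl⟩ := hL
  exact hP _ _ hp

/-- The one-parameter group generated by a tridiagonal matrix with zero diagonal and positive
entries next to the diagonal. -/
structure IsTridiagFlow (c : Fin n → Fin n → ℝ)
    (T : ℝ → (Fin n → ℝ) →L[ℝ] (Fin n → ℝ)) : Prop where
  pos : ∀ i j, Adj i j → 0 < c i j
  map_zero : T 0 = 1
  map_add : ∀ s t, T (s + t) = T s * T t
  hasDerivAt : HasDerivAt T (tridiag c) 0

namespace IsTridiagFlow

variable {c : Fin n → Fin n → ℝ} {T : ℝ → (Fin n → ℝ) →L[ℝ] (Fin n → ℝ)}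

theorem map_div_pow (hT : IsTridiagFlow c T) (t : ℝ) {k : ℕ} (hk : k ≠ 0) :
    T (t / k) ^ k = T t := by
  have : ∀ (s : ℝ) (k : ℕ), T s ^ k = T (k * s) := by
    intro s k
    induction k with
    | zero => simp [hT.map_zero]
    | succ k ih =>
      rw [pow_succ, ih, ← hT.map_add]
      push_cast
      ring_nf
  rw [this, mul_div_cancel₀]
  exact Nat.cast_ne_zero.2 hk

theorem hasDerivAt_apply (hT : IsTridiagFlow c T) (y : Fin n → ℝ) (t : ℝ) (i : Fin n) :
    HasDerivAt (fun s => T s y i) (tridiag c (T t y) i) t := by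
  have h0 : HasDerivAt (fun s => T (s - t)) (tridiag c) t := by
    have h1 : HasDerivAt T (tridiag c) (t - t) := by
      rw [sub_self]
      exact hT.hasDerivAt
    exact h1.comp_sub_const t t
  have h1 := h0.clm_apply (hasDerivAt_const t (T t y))
  rw [_root_.map_zero, add_zero] at h1
  have h2 := hasDerivAt_pi.1 h1 i
  have h3 : (fun s => T (s - t) (T t y) i) = fun s => T s y i := by
    ext s
    rw [← mul_apply_eq_comp, ← hT.map_add, sub_add_cancel]
  rwa [h3] at h2

/-- A closed set that is preserved by the elementary operators is preserved by the flow. -/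
theorem mem_of_isClosed [NeZero n] (hT : IsTridiagFlow c T) {P : Set (Fin n → ℝ)}
    (hP : IsClosed P) {t : ℝ}
    (hstep : ∀ k : ℕ, ∀ i j, Adj i j → ∀ y ∈ P, (1 + (t / k * c i j) • unit i j) y ∈ P)
    {y : Fin n → ℝ} (hy : y ∈ P) : T t y ∈ P := by
  have h1 := tendsto_pow_sub_pow (elementaryProd_zero c) hT.map_zero
    (hasDerivAt_elementaryProd c) hT.hasDerivAt t
  have h2 : Tendsto (fun k : ℕ => elementaryProd c (t / k) ^ k) atTop (𝓝 (T t)) := by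
    have h3 := h1.add_const (T t)
    rw [zero_add] at h3
    refine h3.congr' ?_
    filter_upwards [eventually_ne_atTop 0] with k hk
    rw [hT.map_div_pow t hk, sub_add_cancel]
  have h3 : Tendsto (fun k : ℕ => (elementaryProd c (t / k) ^ k) y) atTop (𝓝 (T t y)) :=
    ((ContinuousLinearMap.apply ℝ (Fin n → ℝ) y).continuous.tendsto _).comp h2
  refine hP.mem_of_tendsto h3 (Eventually.of_forall fun k => ?_)
  rw [← List.prod_replicate]
  refine list_prod_mem _ (fun L hL z hz => ?_) y hy
  rw [List.eq_of_mem_replicate hL]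
  exact elementaryProd_mem (hstep k) z hz

variable {κ : (Fin n → Bool) → ℕ} {m : ℕ}

theorem mem_lowSet [NeZero n] (hT : IsTridiagFlow c T) (hκ : IsVariation κ) {t : ℝ} (ht : 0 ≤ t)
    {y : Fin n → ℝ} (hy : y ∈ lowSet κ m) : T t y ∈ lowSet κ m :=
  hT.mem_of_isClosed (isClosed_lowSet κ m) (fun k i j hij _ hz =>
    elementary_mem_lowSet hκ hij
      (mul_nonneg (div_nonneg ht (Nat.cast_nonneg k)) (hT.pos i j hij).le) hz) hy

theorem mem_lowInterior [NeZero n] (hT : IsTridiagFlow c T) (hκ : IsVariation κ) {t : ℝ}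
    (ht : 0 ≤ t) {y : Fin n → ℝ} (hy : y ∈ lowInterior κ m) : T t y ∈ lowInterior κ m := by
  by_contra h
  have h1 : T (-t) (T t y) ∈ (lowInterior κ m)ᶜ :=
    hT.mem_of_isClosed (isOpen_lowInterior κ m).isClosed_compl (fun k i j hij z hz => by
      have := elementary_not_mem_lowInterior hκ hij
        (mul_nonneg (div_nonneg ht (Nat.cast_nonneg k)) (hT.pos i j hij).le) hz
      rwa [neg_div, neg_mul]) h
  rw [← mul_apply_eq_comp, ← hT.map_add, neg_add_cancel, hT.map_zero] at h1
  exact h1 hy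

end IsTridiagFlow

/-- If every zero entry of `y` has neighbours of opposite signs, then all sign words of `y` have
the same number of changes. -/
theorem variation_le_of_compat {κ : (Fin n → Bool) → ℕ} (hκ : IsVariation κ) {y : Fin n → ℝ}
    (hy : ∀ i, y i = 0 → ∃ j k, Adj i j ∧ Adj i k ∧ y j * y k < 0) {ε ε' : Fin n → Bool}
    (hε : Compat ε y) (hε' : Compat ε' y) : κ ε' ≤ κ ε := by
  obtain ⟨d, hd⟩ : ∃ d, d = (Finset.univ.filter fun i => ε i ≠ ε' i).card := ⟨_, rfl⟩
  induction d generalizing ε with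
  | zero =>
    have : ε = ε' := by
      ext i
      by_contra h
      have := Finset.card_eq_zero.1 hd.symm
      exact Finset.notMem_empty i (this ▸ Finset.mem_filter.2 ⟨Finset.mem_univ i, by simpa using h⟩)
    rw [this]
  | succ d ih =>
    obtain ⟨i, hi⟩ : (Finset.univ.filter fun i => ε i ≠ ε' i).Nonempty := by
      rw [← Finset.card_pos]
      omega
    have hne := (Finset.mem_filter.1 hi).2
    have hyi : y i = 0 := by
      by_contra h
      exact hne (eq_of_mul_pos h (hε i) (hε' i))
    obtain ⟨j, k, hj, hk, hjk⟩ := hy i hyi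
    have hjk' : ε j ≠ ε k := by
      intro h
      have h1 := hε j
      have h2 := hε k
      rw [← h] at h2
      have h3 := mul_nonneg h1 h2
      have h4 := sgn_mul_self (ε j)
      nlinarith
    have hval : ε' i = ε j ∨ ε' i = ε k := by
      revert hjk'
      cases ε' i <;> cases ε j <;> cases ε k <;> simp
    have hle : κ (Function.update ε i (ε' i)) ≤ κ ε := by
      rcases hval with h | h
      · rw [h]
        exact hκ ε i j hj
      · rw [h]
        exact hκ ε i k hk
    refine (ih (ε := Function.update ε i (ε' i)) (fun l => ?_) ?_).trans hle
    · by_cases hl : l = i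
      · subst hl
        simp [hyi]
      · simpa [hl] using hε l
    · have : (Finset.univ.filter fun l => Function.update ε i (ε' i) l ≠ ε' l) =
          (Finset.univ.filter fun l => ε l ≠ ε' l).erase i := by
        ext l
        by_cases hl : l = i
        · subst hl
          simp
        · simp [hl]
      rw [this, Finset.card_erase_of_mem hi, ← hd]
      rfl

theorem tridiag_apply_eq {c : Fin n → Fin n → ℝ} (y : Fin n → ℝ) (i : Fin n) :
    tridiag c y i = (if h : 0 < i.val then c i ⟨i - 1, by omega⟩ * y ⟨i - 1, by omega⟩ else 0) +
      (if h : i.val + 1 < n then c i ⟨i + 1, h⟩ * y ⟨i + 1, h⟩ else 0) := by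
  rw [tridiag_apply]
  have h1 : (Finset.univ.filter fun j => Adj i j) =
      (Finset.univ.filter fun j : Fin n => j.val + 1 = i.val) ∪
        (Finset.univ.filter fun j : Fin n => i.val + 1 = j.val) := by
    ext j
    rw [Finset.mem_union, Finset.mem_filter, Finset.mem_filter, Finset.mem_filter, Adj]
    tauto
  rw [h1, Finset.sum_union]
  · congr 1
    · split_ifs with h
      · rw [Finset.sum_eq_single_of_mem ⟨i - 1, by omega⟩]
        · simp only [Finset.mem_filter, Finset.mem_univ, true_and]
          omega
        · intro j hj hne
          simp only [Finset.mem_filter, Finset.mem_univ, true_and] at hj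
          exact absurd (Fin.ext (by simp only; omega)) hne
      · refine Finset.sum_eq_zero fun j hj => ?_
        simp only [Finset.mem_filter, Finset.mem_univ, true_and] at hj
        omega
    · split_ifs with h
      · rw [Finset.sum_eq_single_of_mem ⟨i + 1, h⟩]
        · simp
        · intro j hj hne
          simp only [Finset.mem_filter, Finset.mem_univ, true_and] at hj
          exact absurd (Fin.ext (by simp only; omega)) hne
      · refine Finset.sum_eq_zero fun j hj => ?_
        simp only [Finset.mem_filter, Finset.mem_univ, true_and] at hj
        omega
  · rw [Finset.disjoint_left]
    intro j hj hj'
    simp only [Finset.mem_filter, Finset.mem_univ, true_and] at hj hj'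
    omega

/-- If the zeros of `y ≠ 0` are also zeros of its image under the tridiagonal matrix, then every
zero of `y` lies between entries of opposite signs: two adjacent zeros would spread over the whole
path. -/
theorem exists_adj_mul_neg {c : Fin n → Fin n → ℝ} (hc : ∀ i j, Adj i j → 0 < c i j)
    {y : Fin n → ℝ} (hy : y ≠ 0) (h : ∀ i, y i = 0 → tridiag c y i = 0) (i : Fin n)
    (hi : y i = 0) : ∃ j k, Adj i j ∧ Adj i k ∧ y j * y k < 0 := by
  by_contra! hcon
  apply hy
  -- a zero next to a zero passes zero on to the other neighbour
  have right : ∀ a b d : Fin n, a.val + 1 = b.val → b.val + 1 = d.val → y a = 0 → y b = 0 →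
      y d = 0 := by
    intro a b d hab hbd ha hb
    have h1 := h b hb
    rw [tridiag_apply_eq, dif_pos (by omega), dif_pos (by omega)] at h1
    have e1 : (⟨b - 1, by omega⟩ : Fin n) = a := Fin.ext (by simp only; omega)
    have e2 : (⟨b + 1, by omega⟩ : Fin n) = d := Fin.ext (by simp only; omega)
    rw [e1, e2, ha, mul_zero, zero_add] at h1
    exact (mul_eq_zero.1 h1).resolve_left (hc b d (Or.inl hbd)).ne'
  have left : ∀ a b d : Fin n, a.val + 1 = b.val → b.val + 1 = d.val → y d = 0 → y b = 0 →
      y a = 0 := by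
    intro a b d hab hbd hd hb
    have h1 := h b hb
    rw [tridiag_apply_eq, dif_pos (by omega), dif_pos (by omega)] at h1
    have e1 : (⟨b - 1, by omega⟩ : Fin n) = a := Fin.ext (by simp only; omega)
    have e2 : (⟨b + 1, by omega⟩ : Fin n) = d := Fin.ext (by simp only; omega)
    rw [e1, e2, hd, mul_zero, add_zero] at h1
    exact (mul_eq_zero.1 h1).resolve_left (hc b a (Or.inr hab)).ne'
  have nbr : ∀ j, Adj i j → y j = 0 := by
    have h1 := h i hi
    rw [tridiag_apply_eq] at h1
    intro j hj
    by_cases hl : 0 < i.val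
    · by_cases hr : i.val + 1 < n
      · rw [dif_pos hl, dif_pos hr] at h1
        have ha : Adj i ⟨i - 1, by omega⟩ := Or.inr (by simp only; omega)
        have hb : Adj i ⟨i + 1, hr⟩ := Or.inl rfl
        have h2 := hcon _ _ ha hb
        have h3 := hc _ _ ha
        have h4 := hc _ _ hb
        have h5 : y ⟨i - 1, by omega⟩ = 0 ∧ y ⟨i + 1, hr⟩ = 0 := by
          generalize y ⟨i - 1, by omega⟩ = u at *
          generalize y ⟨i + 1, hr⟩ = w at *
          generalize c i ⟨i - 1, by omega⟩ = p at *
          generalize c i ⟨i + 1, hr⟩ = q at *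
          have h6 : p * u ^ 2 = - (q * (u * w)) := by linear_combination u * h1
          have h7 : u ^ 2 = 0 := by
            have : p * u ^ 2 ≤ 0 := by rw [h6]; nlinarith
            nlinarith [sq_nonneg u]
          have h8 : u = 0 := by simpa using h7
          rw [h8, mul_zero, zero_add] at h1
          exact ⟨h8, (mul_eq_zero.1 h1).resolve_left h4.ne'⟩
        rcases hj with hj | hj
        · exact (Fin.ext hj : (⟨i + 1, hr⟩ : Fin n) = j) ▸ h5.2
        · exact (Fin.ext (by simp only; omega) : (⟨i - 1, by omega⟩ : Fin n) = j) ▸ h5.1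
      · rw [dif_pos hl, dif_neg hr, add_zero] at h1
        have e1 : (⟨i - 1, by omega⟩ : Fin n) = j :=
          Fin.ext (by rcases hj with hj | hj <;> simp only <;> omega)
        rw [e1] at h1
        exact (mul_eq_zero.1 h1).resolve_left (hc i j hj).ne'
    · by_cases hr : i.val + 1 < n
      · rw [dif_neg hl, dif_pos hr, zero_add] at h1
        have e1 : (⟨i + 1, hr⟩ : Fin n) = j :=
          Fin.ext (by rcases hj with hj | hj <;> simp only <;> omega)
        rw [e1] at h1
        exact (mul_eq_zero.1 h1).resolve_left (hc i j hj).ne'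
      · rcases hj with hj | hj <;> omega
  have up : ∀ d : ℕ, ∀ a : Fin n, a.val = i.val + d → y a = 0 := by
    intro d
    induction d using Nat.strong_induction_on with
    | _ d ih =>
      intro a ha
      match d, ih, ha with
      | 0, _, ha => exact (Fin.ext ha : a = i) ▸ hi
      | 1, _, ha => exact nbr a (Or.inl ha.symm)
      | d + 2, ih, ha =>
        exact right ⟨a - 2, by omega⟩ ⟨a - 1, by omega⟩ a (by simp only; omega)
          (by simp only; omega) (ih d (by omega) _ (by simp only; omega))
          (ih (d + 1) (by omega) _ (by simp only; omega))
  have down : ∀ d : ℕ, ∀ a : Fin n, a.val + d = i.val → y a = 0 := by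
    intro d
    induction d using Nat.strong_induction_on with
    | _ d ih =>
      intro a ha
      match d, ih, ha with
      | 0, _, ha => exact (Fin.ext ha : a = i) ▸ hi
      | 1, _, ha => exact nbr a (Or.inr ha)
      | d + 2, ih, ha =>
        exact left a ⟨a + 1, by omega⟩ ⟨a + 2, by omega⟩ rfl rfl
          (ih d (by omega) _ (by simp only; omega))
          (ih (d + 1) (by omega) _ (by simp only; omega))
  ext a
  rcases le_total i.val a.val with h1 | h1
  · exact up (a - i) a (by omega)
  · exact down (i - a) a (by omega)

/-- Finitely many continuous functions can be restricted to an open interval on which each of them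
is identically zero or has no zero. -/
theorem exists_Ioo_zero_or_ne {ι : Type*} (s : Finset ι) {f : ι → ℝ → ℝ}
    (hf : ∀ i, Continuous (f i)) {a b : ℝ} (hab : a < b) :
    ∃ a' b', a ≤ a' ∧ a' < b' ∧ b' ≤ b ∧
      ∀ i ∈ s, (∀ t ∈ Ioo a' b', f i t = 0) ∨ ∀ t ∈ Ioo a' b', f i t ≠ 0 := by
  classical
  induction s using Finset.induction_on with
  | empty => exact ⟨a, b, le_rfl, hab, le_rfl, by simp⟩
  | insert i s _ ih =>
    obtain ⟨a', b', h1, h2, h3, h4⟩ := ih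
    by_cases h0 : ∀ t ∈ Ioo a' b', f i t = 0
    · refine ⟨a', b', h1, h2, h3, fun j hj => ?_⟩
      rcases Finset.mem_insert.1 hj with rfl | hj
      · exact Or.inl h0
      · exact h4 j hj
    · push Not at h0
      obtain ⟨t, ht, ht0⟩ := h0
      have hopen : ∀ᶠ x in 𝓝[>] t, x ∈ Ioo a' b' ∧ f i x ≠ 0 :=
        nhdsWithin_le_nhds ((show ∀ᶠ x in 𝓝 t, x ∈ Ioo a' b' from Ioo_mem_nhds ht.1 ht.2).and
          ((hf i).continuousAt.eventually_ne ht0))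
      obtain ⟨u, hu, hsub⟩ := mem_nhdsGT_iff_exists_Ioo_subset.1 hopen
      have hu : t < u := hu
      refine ⟨t, min u b', h1.trans ht.1.le, lt_min hu ht.2, (min_le_right _ _).trans h3,
        fun j hj => ?_⟩
      rcases Finset.mem_insert.1 hj with rfl | hj
      · exact Or.inr fun x hx => (hsub ⟨hx.1, hx.2.trans_le (min_le_left _ _)⟩).2
      · have hx : ∀ x ∈ Ioo t (min u b'), x ∈ Ioo a' b' := fun x hx =>
          ⟨ht.1.trans hx.1, hx.2.trans_le (min_le_right _ _)⟩
        exact (h4 j hj).imp (fun h x hx' => h x (hx x hx')) fun h x hx' => h x (hx x hx')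

/-- Strict variation diminution: the flow carries `lowSet` into `lowInterior` at positive times.
At some moment before `t` every coordinate is nonzero or vanishes identically for a while; then all
sign words have the same number of changes, and from there on `lowInterior` is preserved. -/
theorem IsTridiagFlow.mem_lowInterior_of_mem_lowSet [NeZero n] {c : Fin n → Fin n → ℝ}
    {T : ℝ → (Fin n → ℝ) →L[ℝ] (Fin n → ℝ)} (hT : IsTridiagFlow c T) {κ : (Fin n → Bool) → ℕ}
    (hκ : IsVariation κ) {m : ℕ} {t : ℝ} (ht : 0 < t) {y : Fin n → ℝ} (hy0 : y ≠ 0)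
    (hy : y ∈ lowSet κ m) : T t y ∈ lowInterior κ m := by
  have hcont : ∀ i, Continuous fun s => T s y i := fun i =>
    continuous_iff_continuousAt.2 fun s => (hT.hasDerivAt_apply y s i).continuousAt
  obtain ⟨a, b, h1, h2, h3, h4⟩ := exists_Ioo_zero_or_ne Finset.univ hcont ht
  obtain ⟨s, hs⟩ := exists_between h2
  have hs0 : T s y ≠ 0 := fun h => hy0 <| by
    have : T (-s) (T s y) = y := by
      rw [← mul_apply_eq_comp, ← hT.map_add, neg_add_cancel, hT.map_zero]
      rfl
    rw [← this, h, _root_.map_zero]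
  have hreg := exists_adj_mul_neg hT.pos hs0 (fun i hi => by
    rcases h4 i (Finset.mem_univ i) with h5 | h5
    · have h6 : (fun s => T s y i) =ᶠ[𝓝 s] fun _ => 0 :=
        eventually_of_mem (Ioo_mem_nhds hs.1 hs.2) h5
      exact ((hT.hasDerivAt_apply y s i).congr_of_eventuallyEq h6.symm).unique
        (hasDerivAt_const s 0)
    · exact absurd hi (h5 s hs))
  obtain ⟨ε, hε, hm⟩ := hT.mem_lowSet hκ (h1.trans hs.1.le) hy
  have h5 : T s y ∈ lowInterior κ m := fun ε' hε' =>
    (variation_le_of_compat hκ hreg hε hε').trans hm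
  have h6 := hT.mem_lowInterior hκ (sub_nonneg.2 (hs.2.le.trans h3)) h5
  rwa [← mul_apply_eq_comp, ← hT.map_add, sub_add_cancel] at h6

end SignWord

/-! ### Diagonalizable tridiagonal flows on the sphere of rays -/

namespace SignWord

variable {n : ℕ}

/-- The columns of `V` are eigenvectors of the tridiagonal matrix `c`, with the eigenvalues `l` in
strictly decreasing order; `W` is the inverse of `V`. -/
structure IsEigenbasis (c : Fin n → Fin n → ℝ) (l : Fin n → ℝ) (V W : Matrix (Fin n) (Fin n) ℝ) :
    Prop where
  pos : ∀ i j, Adj i j → 0 < c i j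
  mul_eq_one : V * W = 1
  eigen : ∀ j, tridiag c (fun i => V i j) = l j • fun i => V i j
  strictAnti : StrictAnti l

/-- The operator that multiplies the `j`-th coordinate in the basis of columns of `V` by
`exp (l j * t)`. -/
noncomputable def diagFlow (l : Fin n → ℝ) (V W : Matrix (Fin n) (Fin n) ℝ) (t : ℝ) :
    (Fin n → ℝ) →L[ℝ] (Fin n → ℝ) :=
  ∑ j, Real.exp (l j * t) •
    ((ContinuousLinearMap.proj (R := ℝ) (φ := fun _ : Fin n => ℝ) j).comp
      (Matrix.mulVecLin W).toContinuousLinearMap).smulRight (fun i => V i j)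

variable {c : Fin n → Fin n → ℝ} {l : Fin n → ℝ} {V W : Matrix (Fin n) (Fin n) ℝ}

theorem diagFlow_apply (t : ℝ) (y : Fin n → ℝ) :
    diagFlow l V W t y = ∑ j, (Real.exp (l j * t) * W.mulVec y j) • fun i => V i j := by
  simp [diagFlow, smul_smul]

theorem diagFlow_apply_eq_mulVec (t : ℝ) (y : Fin n → ℝ) :
    diagFlow l V W t y = V.mulVec fun j => Real.exp (l j * t) * W.mulVec y j := by
  ext i
  simp [diagFlow_apply, Matrix.mulVec, dotProduct, mul_comm]

theorem continuous_diagFlow : Continuous (diagFlow l V W) := by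
  unfold diagFlow
  fun_prop

namespace IsEigenbasis

theorem mul_eq_one' (h : IsEigenbasis c l V W) : W * V = 1 :=
  mul_eq_one_comm.1 h.mul_eq_one

theorem mulVec_mulVec (h : IsEigenbasis c l V W) (y : Fin n → ℝ) :
    V.mulVec (W.mulVec y) = y := by
  rw [Matrix.mulVec_mulVec, h.mul_eq_one, Matrix.one_mulVec]

theorem mulVec_mulVec' (h : IsEigenbasis c l V W) (x : Fin n → ℝ) :
    W.mulVec (V.mulVec x) = x := by
  rw [Matrix.mulVec_mulVec, h.mul_eq_one', Matrix.one_mulVec]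

theorem mulVec_ne_zero (h : IsEigenbasis c l V W) {y : Fin n → ℝ} (hy : y ≠ 0) :
    W.mulVec y ≠ 0 := fun h0 => hy <| by
  rw [← h.mulVec_mulVec y, h0, Matrix.mulVec_zero]

theorem mulVec_col (h : IsEigenbasis c l V W) (j : Fin n) (r : ℝ) :
    W.mulVec (r • fun i => V i j) = Pi.single j r := by
  have h1 : (r • fun i => V i j) = V.mulVec (Pi.single j r) := by
    ext i
    simp [mul_comm]
  rw [h1, h.mulVec_mulVec']

theorem mulVec_diagFlow (h : IsEigenbasis c l V W) (t : ℝ) (y : Fin n → ℝ) (j : Fin n) :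
    W.mulVec (diagFlow l V W t y) j = Real.exp (l j * t) * W.mulVec y j := by
  rw [diagFlow_apply_eq_mulVec, h.mulVec_mulVec']

theorem isTridiagFlow (h : IsEigenbasis c l V W) : IsTridiagFlow c (diagFlow l V W) where
  pos := h.pos
  map_zero := by
    ext1 y
    rw [diagFlow_apply_eq_mulVec]
    simp only [mul_zero, Real.exp_zero, one_mul, h.mulVec_mulVec]
    rfl
  map_add s t := by
    ext1 y
    rw [mul_apply_eq_comp, diagFlow_apply_eq_mulVec, diagFlow_apply_eq_mulVec s]
    congr 1
    ext j
    rw [h.mulVec_diagFlow, mul_add, Real.exp_add, mul_assoc]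
  hasDerivAt := by
    have h1 : HasDerivAt (diagFlow l V W) (∑ j, (l j) •
        ((ContinuousLinearMap.proj (R := ℝ) (φ := fun _ : Fin n => ℝ) j).comp
        (Matrix.mulVecLin W).toContinuousLinearMap).smulRight (fun i => V i j)) 0 := by
      unfold diagFlow
      refine HasDerivAt.fun_sum fun j _ => ?_
      have h2 : HasDerivAt (fun t => Real.exp (l j * t)) (l j) 0 := by
        have := ((hasDerivAt_id (0 : ℝ)).const_mul (l j)).exp
        simpa using this
      exact h2.smul_const (_ : (Fin n → ℝ) →L[ℝ] (Fin n → ℝ))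
    convert h1 using 1
    ext1 y
    conv_lhs => rw [← h.mulVec_mulVec y]
    have h3 : V.mulVec (W.mulVec y) = ∑ j, W.mulVec y j • fun i => V i j := by
      ext i
      simp [Matrix.mulVec, dotProduct, mul_comm]
    rw [h3, map_sum]
    simp only [map_smul, h.eigen]
    simp [smul_smul, mul_comm]

theorem diagFlow_ne_zero (h : IsEigenbasis c l V W) (t : ℝ) {y : Fin n → ℝ} (hy : y ≠ 0) :
    diagFlow l V W t y ≠ 0 := fun h0 => hy <| by
  have h1 : diagFlow l V W (-t) (diagFlow l V W t y) = y := by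
    rw [← mul_apply_eq_comp, ← h.isTridiagFlow.map_add, neg_add_cancel, h.isTridiagFlow.map_zero]
    rfl
  rw [← h1, h0, map_zero]

end IsEigenbasis

/-- The boundary of the cross polytope in `Fin n → ℝ`, one point for each ray from the origin. -/
def RaySphere (n : ℕ) : Type := {y : Fin n → ℝ // ∑ i, |y i| = 1}

namespace RaySphere

instance : TopologicalSpace (RaySphere n) :=
  inferInstanceAs (TopologicalSpace {_y : Fin n → ℝ // _})
instance : T2Space (RaySphere n) := inferInstanceAs (T2Space {_y : Fin n → ℝ // _})

instance : CompactSpace (RaySphere n) := by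
  suffices h : IsCompact {y : Fin n → ℝ | ∑ i, |y i| = 1} from isCompact_iff_compactSpace.1 h
  refine Metric.isCompact_of_isClosed_isBounded (isClosed_eq (by fun_prop) continuous_const) ?_
  refine (Metric.isBounded_closedBall (x := (0 : Fin n → ℝ)) (r := 1)).subset fun y hy => ?_
  rw [mem_closedBall_zero_iff, pi_norm_le_iff_of_nonneg zero_le_one]
  intro i
  rw [Real.norm_eq_abs, ← (show ∑ i, |y i| = 1 from hy)]
  exact Finset.single_le_sum (fun j _ => abs_nonneg (y j)) (Finset.mem_univ i)

theorem ne_zero (y : RaySphere n) : y.1 ≠ 0 := fun h => by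
  have := y.2
  simp [h] at this

theorem sum_abs_pos {y : Fin n → ℝ} (hy : y ≠ 0) : 0 < ∑ i, |y i| := by
  obtain ⟨i, hi⟩ := Function.ne_iff.1 hy
  exact Finset.sum_pos' (fun j _ => abs_nonneg (y j)) ⟨i, Finset.mem_univ i, abs_pos.2 hi⟩

/-- The point on the ray through `y`. -/
noncomputable def ofNeZero (y : Fin n → ℝ) (hy : y ≠ 0) : RaySphere n :=
  ⟨(∑ i, |y i|)⁻¹ • y, by
    have := sum_abs_pos hy
    simp only [Pi.smul_apply, smul_eq_mul, abs_mul, ← Finset.mul_sum, abs_inv, abs_of_pos this]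
    exact inv_mul_cancel₀ this.ne'⟩

theorem ofNeZero_smul (y : RaySphere n) {r : ℝ} (hr : 0 < r) (h : r • y.1 ≠ 0) :
    ofNeZero (r • y.1) h = y := by
  apply Subtype.ext
  simp only [ofNeZero, Pi.smul_apply, smul_eq_mul, abs_mul, ← Finset.mul_sum, y.2, mul_one,
    abs_of_pos hr, smul_smul, inv_mul_cancel₀ hr.ne', one_smul]

theorem ofNeZero_eq_iff {y z : Fin n → ℝ} (hy : y ≠ 0) (hz : z ≠ 0) :
    ofNeZero y hy = ofNeZero z hz ↔ ∃ r : ℝ, 0 < r ∧ y = r • z := by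
  constructor
  · intro h
    have h1 : (∑ i, |y i|)⁻¹ • y = (∑ i, |z i|)⁻¹ • z := congrArg Subtype.val h
    refine ⟨(∑ i, |y i|) * (∑ i, |z i|)⁻¹,
      mul_pos (sum_abs_pos hy) (inv_pos.2 (sum_abs_pos hz)), ?_⟩
    rw [← smul_smul, ← h1, smul_smul, mul_inv_cancel₀ (sum_abs_pos hy).ne', one_smul]
  · rintro ⟨r, hr, rfl⟩
    apply Subtype.ext
    simp only [ofNeZero, Pi.smul_apply, smul_eq_mul, abs_mul, ← Finset.mul_sum, abs_of_pos hr,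
      smul_smul]
    congr 1
    field_simp

theorem continuous_ofNeZero {Y : Type*} [TopologicalSpace Y] {f : Y → Fin n → ℝ}
    (hf : Continuous f) (h0 : ∀ p, f p ≠ 0) : Continuous fun p => ofNeZero (f p) (h0 p) := by
  have h1 : Continuous fun p => (∑ i, |f p i|)⁻¹ := by
    refine Continuous.inv₀ (by fun_prop) fun p => (sum_abs_pos (h0 p)).ne'
  exact (h1.smul hf).subtype_mk _

theorem ofNeZero_mem_iff {C : Set (Fin n → ℝ)} (hC : ∀ r : ℝ, 0 < r → ∀ y, r • y ∈ C ↔ y ∈ C)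
    {y : Fin n → ℝ} (hy : y ≠ 0) : (ofNeZero y hy).1 ∈ C ↔ y ∈ C :=
  hC _ (inv_pos.2 (sum_abs_pos hy)) y

end RaySphere

open RaySphere

/-- The flow of a diagonalizable tridiagonal matrix on the space of rays. -/
noncomputable def IsEigenbasis.rayFlow (h : IsEigenbasis c l V W) : Flow ℝ (RaySphere n) where
  toFun t y := ofNeZero (diagFlow l V W t y.1) (h.diagFlow_ne_zero t y.ne_zero)
  cont' := by
    refine continuous_ofNeZero (f := fun p : ℝ × RaySphere n => diagFlow l V W p.1 p.2.1) ?_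
      fun p => h.diagFlow_ne_zero p.1 p.2.ne_zero
    exact (continuous_diagFlow.comp continuous_fst).clm_apply
      (continuous_subtype_val.comp continuous_snd)
  map_add' s t y := by
    rw [ofNeZero_eq_iff]
    refine ⟨∑ i, |diagFlow l V W t y.1 i|, sum_abs_pos (h.diagFlow_ne_zero t y.ne_zero), ?_⟩
    rw [h.isTridiagFlow.map_add, mul_apply_eq_comp, ← map_smul]
    congr 1
    simp only [ofNeZero]
    rw [smul_smul, mul_inv_cancel₀ (sum_abs_pos (h.diagFlow_ne_zero t y.ne_zero)).ne', one_smul]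
  map_zero' y := by
    have h1 := ofNeZero_smul y one_pos (by simpa using y.ne_zero)
    simp only [one_smul] at h1
    conv_rhs => rw [← h1]
    rw [ofNeZero_eq_iff]
    refine ⟨1, one_pos, ?_⟩
    rw [h.isTridiagFlow.map_zero]
    simp

/-- A direction `r` times the `j`-th eigenvector is ahead of the threshold `μ` if its eigenvalue
exceeds `μ`, or equals `μ` and `r` is positive. -/
def IsAhead (l : Fin n → ℝ) (μ : ℝ) (j : Fin n) (r : ℝ) : Prop := μ < l j ∨ μ = l j ∧ 0 < r

/-- A pair of a closed cone `C` and an open cone `O` in it that is strictly preserved by the flow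
and that separates the eigenvectors by the threshold `μ`. -/
structure IsAdapted (l : Fin n → ℝ) (V W : Matrix (Fin n) (Fin n) ℝ) (μ : ℝ)
    (C O : Set (Fin n → ℝ)) : Prop where
  isClosed : IsClosed C
  isOpen : IsOpen O
  subset : O ⊆ C
  smul_mem_iff : ∀ r : ℝ, 0 < r → ∀ y, r • y ∈ C ↔ y ∈ C
  smul_mem_iff' : ∀ r : ℝ, 0 < r → ∀ y, r • y ∈ O ↔ y ∈ O
  map_mem : ∀ t > 0, ∀ y ∈ C, y ≠ 0 → diagFlow l V W t y ∈ O
  isAhead : ∀ j r, r ≠ 0 → (r • fun i => V i j) ∈ C → IsAhead l μ j r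
  mem_of_isAhead : ∀ j r, r ≠ 0 → IsAhead l μ j r → (r • fun i => V i j) ∈ O

namespace IsAdapted

variable {μ : ℝ} {C O C' O' : Set (Fin n → ℝ)}

theorem isTrapping (hA : IsAdapted l V W μ C O) (h : IsEigenbasis c l V W) :
    h.rayFlow.IsTrapping ((fun y : RaySphere n => y.1) ⁻¹' C) ((fun y => y.1) ⁻¹' O) where
  isClosed := hA.isClosed.preimage continuous_subtype_val
  isOpen := hA.isOpen.preimage continuous_subtype_val
  subset := preimage_mono hA.subset
  mem_of_pos t ht y hy := (ofNeZero_mem_iff hA.smul_mem_iff'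
    (h.diagFlow_ne_zero t y.ne_zero)).2 (hA.map_mem t ht _ hy y.ne_zero)

/-- Rescaled by its leading growth rate, an orbit converges to its leading eigenvector. -/
theorem _root_.SignWord.IsEigenbasis.tendsto_leading (h : IsEigenbasis c l V W) {y : Fin n → ℝ}
    {j : Fin n} (hj : ∀ k < j, W.mulVec y k = 0) :
    Tendsto (fun t => Real.exp (-(l j * t)) • diagFlow l V W t y) atTop
      (𝓝 (W.mulVec y j • fun i => V i j)) := by
  have h1 : ∀ t, Real.exp (-(l j * t)) • diagFlow l V W t y =
      ∑ k, (Real.exp ((l k - l j) * t) * W.mulVec y k) • fun i => V i k := fun t => by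
    rw [diagFlow_apply, Finset.smul_sum]
    refine Finset.sum_congr rfl fun k _ => ?_
    rw [smul_smul, ← mul_assoc, ← Real.exp_add]
    ring_nf
  have h2 : (W.mulVec y j • fun i => V i j) =
      ∑ k, (if k = j then W.mulVec y j else 0) • fun i => V i k := by
    simp [ite_smul]
  simp only [h1]
  rw [h2]
  refine tendsto_finsetSum _ fun k _ => Tendsto.smul_const ?_ _
  rcases lt_trichotomy k j with hk | rfl | hk
  · simp [hj k hk, hk.ne]
  · simp
  · have h3 : l k - l j < 0 := sub_neg.2 (h.strictAnti hk)
    rw [if_neg hk.ne']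
    have h4 : Tendsto (fun t => Real.exp ((l k - l j) * t)) atTop (𝓝 0) :=
      Real.tendsto_exp_atBot.comp (tendsto_id.const_mul_atTop_of_neg h3)
    simpa using h4.mul_const (W.mulVec y k)

/-- Every orbit from `C` ends up in `O'`: its leading eigenvector lies in `C`, hence is ahead of
the threshold, hence lies in the open set `O'`. -/
theorem exists_mem (hA : IsAdapted l V W μ C O) (hA' : IsAdapted l V W μ C' O')
    (h : IsEigenbasis c l V W) {y : Fin n → ℝ} (hy : y ∈ C) (hy0 : y ≠ 0) :
    ∃ t, diagFlow l V W t y ∈ O' := by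
  classical
  obtain ⟨j, hj, hmin⟩ : ∃ j, W.mulVec y j ≠ 0 ∧ ∀ k < j, W.mulVec y k = 0 := by
    obtain ⟨j, hj⟩ := Function.ne_iff.1 (h.mulVec_ne_zero hy0)
    obtain ⟨i, hi⟩ := (toFinite {j | W.mulVec y j ≠ 0}).exists_minimal ⟨j, hj⟩
    refine ⟨i, hi.1, fun k hk => ?_⟩
    by_contra h0
    exact hi.not_lt h0 hk
  have hlim := h.tendsto_leading hmin
  have hC : (W.mulVec y j • fun i => V i j) ∈ C := by
    refine hA.isClosed.mem_of_tendsto hlim ?_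
    filter_upwards [eventually_gt_atTop 0] with t ht
    exact (hA.smul_mem_iff _ (Real.exp_pos _) _).2 (hA.subset (hA.map_mem t ht y hy hy0))
  have hO := hA'.mem_of_isAhead j _ hj (hA.isAhead j _ hj hC)
  obtain ⟨t, ht⟩ := (hlim.eventually_mem (hA'.isOpen.mem_nhds hO)).exists
  exact ⟨t, (hA'.smul_mem_iff' _ (Real.exp_pos _) _).1 ht⟩

theorem exists_time (hA : IsAdapted l V W μ C O) (hA' : IsAdapted l V W μ C' O')
    (h : IsEigenbasis c l V W) :
    ∃ T > 0, (∀ x ∈ (fun y : RaySphere n => y.1) ⁻¹' C, (h.rayFlow T x).1 ∈ C') ∧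
      ∀ x ∈ (fun y : RaySphere n => y.1) ⁻¹' C', (h.rayFlow T x).1 ∈ C := by
  have key : ∀ {C O C' O'} (_ : IsAdapted l V W μ C O) (_ : IsAdapted l V W μ C' O'),
      ∃ T₀, ∀ T, T₀ ≤ T → ∀ x ∈ (fun y : RaySphere n => y.1) ⁻¹' C,
        (h.rayFlow T x).1 ∈ C' := by
    intro C O C' O' hA hA'
    refine (hA.isTrapping h).exists_forall_mem (hA'.isTrapping h) fun x hx => ?_
    obtain ⟨t, ht⟩ := hA.exists_mem hA' h hx x.ne_zero
    exact ⟨t, (ofNeZero_mem_iff hA'.smul_mem_iff' (h.diagFlow_ne_zero t x.ne_zero)).2 ht⟩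
  obtain ⟨T₁, h1⟩ := key hA hA'
  obtain ⟨T₂, h2⟩ := key hA' hA
  refine ⟨max 1 (max T₁ T₂), by positivity, h1 _ ?_, h2 _ ?_⟩
  · exact (le_max_left _ _).trans (le_max_right _ _)
  · exact (le_max_right _ _).trans (le_max_right _ _)

theorem nonempty_homeomorph (hA : IsAdapted l V W μ C O) (hA' : IsAdapted l V W μ C' O')
    (h : IsEigenbasis c l V W) :
    Nonempty ({y : RaySphere n | y.1 ∈ C} ≃ₜ {y : RaySphere n | y.1 ∈ C'}) := by
  obtain ⟨T, hT, h1, h2⟩ := hA.exists_time hA' h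
  exact (hA.isTrapping h).nonempty_homeomorph (hA'.isTrapping h) hT h1 h2

theorem nonempty_homeomorph_section (hA : IsAdapted l V W μ C O)
    (hA' : IsAdapted l V W μ C' O') (h : IsEigenbasis c l V W) :
    Nonempty ({y : RaySphere n | y.1 ∈ C \ O} ≃ₜ {y : RaySphere n | y.1 ∈ C' \ O'}) := by
  obtain ⟨T, hT, h1, h2⟩ := hA.exists_time hA' h
  exact (hA.isTrapping h).nonempty_homeomorph_section (hA'.isTrapping h) hT h1 h2

end IsAdapted

/-- Regions of few sign changes are adapted as soon as the eigenvectors are on the right sides. -/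
theorem isAdapted_lowSet [NeZero n] (h : IsEigenbasis c l V W) {κ : (Fin n → Bool) → ℕ}
    (hκ : IsVariation κ) {μ : ℝ} {m : ℕ}
    (h1 : ∀ j b, (sgn b • fun i => V i j) ∈ lowSet κ m → IsAhead l μ j (sgn b))
    (h2 : ∀ j b, IsAhead l μ j (sgn b) → (sgn b • fun i => V i j) ∈ lowInterior κ m) :
    IsAdapted l V W μ (lowSet κ m) (lowInterior κ m) := by
  have hsgn : ∀ r : ℝ, r ≠ 0 → ∃ b, r = |r| * sgn b := fun r hr => by
    rcases hr.lt_or_gt with h | h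
    · exact ⟨false, by simp [abs_of_neg h]⟩
    · exact ⟨true, by simp [abs_of_pos h]⟩
  have hahead : ∀ j (r : ℝ) b, r ≠ 0 → r = |r| * sgn b →
      (IsAhead l μ j r ↔ IsAhead l μ j (sgn b)) := fun j r b hr hb => by
    have : 0 < r ↔ 0 < sgn b := by
      conv_lhs => rw [hb]
      exact mul_pos_iff_of_pos_left (abs_pos.2 hr)
    rw [IsAhead, IsAhead, this]
  exact {
    isClosed := isClosed_lowSet κ m
    isOpen := isOpen_lowInterior κ m
    subset := lowInterior_subset κ m
    smul_mem_iff := fun r hr y => smul_mem_lowSet_iff hr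
    smul_mem_iff' := fun r hr y => smul_mem_lowInterior_iff hr
    map_mem := fun t ht y hy hy0 => h.isTridiagFlow.mem_lowInterior_of_mem_lowSet hκ ht hy0 hy
    isAhead := fun j r hr hmem => by
      obtain ⟨b, hb⟩ := hsgn r hr
      rw [hb, ← smul_smul, smul_mem_lowSet_iff (abs_pos.2 hr)] at hmem
      exact (hahead j r b hr hb).2 (h1 j b hmem)
    mem_of_isAhead := fun j r h0 hr => by
      obtain ⟨b, hb⟩ := hsgn r h0
      rw [hb, ← smul_smul, smul_mem_lowInterior_iff (abs_pos.2 h0)]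
      exact h2 j b ((hahead j r b h0 hb).1 hr) }

end SignWord

/-! ### Quadratic model regions -/

namespace SignWord

variable {n : ℕ} {c : Fin n → Fin n → ℝ} {l : Fin n → ℝ} {V W : Matrix (Fin n) (Fin n) ℝ} {μ : ℝ}

/-- The contribution of the coordinate `r` of an eigenvector with eigenvalue `a` to `modelForm`. -/
noncomputable def modelTerm (μ a r : ℝ) : ℝ :=
  if μ < a then r ^ 2 else if μ = a then r * |r| else -r ^ 2

/-- The sum of the squares of the coordinates whose eigenvalues exceed `μ`, minus the sum of the
squares of those whose eigenvalues are less than `μ`; a coordinate with eigenvalue `μ` itself enters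
with its signed square. -/
noncomputable def modelForm (l : Fin n → ℝ) (μ : ℝ) (x : Fin n → ℝ) : ℝ :=
  ∑ j, modelTerm μ (l j) (x j)

theorem continuous_modelTerm (μ a : ℝ) : Continuous (modelTerm μ a) := by
  unfold modelTerm
  split_ifs <;> fun_prop

theorem continuous_modelForm (l : Fin n → ℝ) (μ : ℝ) : Continuous (modelForm l μ) :=
  continuous_finsetSum _ fun j _ => (continuous_modelTerm μ (l j)).comp (continuous_apply j)

theorem modelTerm_mul {r : ℝ} (hr : 0 < r) (μ a s : ℝ) :
    modelTerm μ a (r * s) = r ^ 2 * modelTerm μ a s := by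
  unfold modelTerm
  split_ifs
  · ring
  · rw [abs_mul, abs_of_pos hr]
    ring
  · ring

theorem modelForm_smul {r : ℝ} (hr : 0 < r) (x : Fin n → ℝ) :
    modelForm l μ (r • x) = r ^ 2 * modelForm l μ x := by
  simp [modelForm, modelTerm_mul hr, Finset.mul_sum]

theorem modelTerm_zero (μ a : ℝ) : modelTerm μ a 0 = 0 := by simp [modelTerm]

theorem modelForm_single (j : Fin n) (r : ℝ) :
    modelForm l μ (Pi.single j r) = modelTerm μ (l j) r := by
  rw [modelForm, Finset.sum_eq_single j]
  · simp
  · intro k _ hk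
    rw [Pi.single_eq_of_ne hk, modelTerm_zero]
  · simp

theorem modelTerm_pos_iff {a r : ℝ} (hr : r ≠ 0) :
    (0 < modelTerm μ a r ↔ μ < a ∨ μ = a ∧ 0 < r) ∧
      (0 ≤ modelTerm μ a r ↔ μ < a ∨ μ = a ∧ 0 < r) := by
  have h1 : 0 < r ^ 2 := by positivity
  have h2 := abs_pos.2 hr
  unfold modelTerm
  split_ifs with h3 h4
  · simp [h3, h1, h1.le]
  · simp [h4, mul_pos_iff_of_pos_right h2, mul_nonneg_iff_of_pos_right h2, hr.symm.le_iff_lt]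
  · simp [h3, h4, h1.le, hr]

/-- Relative to the growth rate `μ`, the flow never decreases a term of the form: the positive terms
grow at least as fast, the negative ones at most as fast. -/
theorem modelTerm_exp_le {a s t : ℝ} (ht : 0 ≤ t) :
    Real.exp (μ * t) ^ 2 * modelTerm μ a s ≤ modelTerm μ a (Real.exp (a * t) * s) := by
  rw [modelTerm_mul (Real.exp_pos _)]
  have hs := sq_nonneg s
  unfold modelTerm
  split_ifs with h1 h2
  · have h3 : Real.exp (μ * t) ≤ Real.exp (a * t) := Real.exp_le_exp.2 (by nlinarith)
    gcongr
  · rw [h2]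
  · have h3 : Real.exp (a * t) ≤ Real.exp (μ * t) :=
      Real.exp_le_exp.2 (by nlinarith [not_lt.1 h1])
    have h4 : Real.exp (a * t) ^ 2 ≤ Real.exp (μ * t) ^ 2 := by gcongr
    nlinarith

theorem modelTerm_exp_lt {a s t : ℝ} (ht : 0 < t) (ha : μ ≠ a) (hs : s ≠ 0) :
    Real.exp (μ * t) ^ 2 * modelTerm μ a s < modelTerm μ a (Real.exp (a * t) * s) := by
  rw [modelTerm_mul (Real.exp_pos _)]
  have hs : 0 < s ^ 2 := by positivity
  unfold modelTerm
  split_ifs with h1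
  · have h3 : Real.exp (μ * t) < Real.exp (a * t) := Real.exp_lt_exp.2 (by nlinarith)
    gcongr
  · have h3 : Real.exp (a * t) < Real.exp (μ * t) :=
      Real.exp_lt_exp.2 (by nlinarith [lt_of_le_of_ne (not_lt.1 h1) ha.symm])
    have h4 : Real.exp (a * t) ^ 2 < Real.exp (μ * t) ^ 2 := by gcongr
    nlinarith

theorem isAdapted_modelForm (h : IsEigenbasis c l V W) (μ : ℝ) :
    IsAdapted l V W μ {y | 0 ≤ modelForm l μ (W.mulVec y)}
      {y | 0 < modelForm l μ (W.mulVec y)} where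
  isClosed := isClosed_le continuous_const
    ((continuous_modelForm l μ).comp (by fun_prop))
  isOpen := isOpen_lt continuous_const
    ((continuous_modelForm l μ).comp (by fun_prop))
  subset _ hy := by
    simp only [mem_ofPred_eq] at *
    exact hy.le
  smul_mem_iff r hr y := by
    simp only [mem_ofPred_eq, Matrix.mulVec_smul, modelForm_smul hr]
    exact mul_nonneg_iff_of_pos_left (by positivity)
  smul_mem_iff' r hr y := by
    simp only [mem_ofPred_eq, Matrix.mulVec_smul, modelForm_smul hr]
    exact mul_pos_iff_of_pos_left (by positivity)
  map_mem t ht y hy hy0 := by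
    have hx := h.mulVec_ne_zero hy0
    have h1 : W.mulVec (diagFlow l V W t y) = fun j => Real.exp (l j * t) * W.mulVec y j :=
      funext (h.mulVec_diagFlow t y)
    simp only [mem_ofPred_eq] at hy ⊢
    rw [h1]
    generalize W.mulVec y = x at *
    have h2 : 0 ≤ Real.exp (μ * t) ^ 2 * modelForm l μ x := by positivity
    by_cases h3 : ∃ j, μ ≠ l j ∧ x j ≠ 0
    · obtain ⟨j, hj, hxj⟩ := h3
      refine h2.trans_lt ?_
      rw [modelForm, modelForm, Finset.mul_sum]
      exact Finset.sum_lt_sum (fun k _ => modelTerm_exp_le ht.le)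
        ⟨j, Finset.mem_univ j, modelTerm_exp_lt ht hj hxj⟩
    · -- only the coordinate with eigenvalue `μ` is present, and the form does not vanish on it
      push Not at h3
      obtain ⟨j, hj⟩ := Function.ne_iff.1 hx
      have hμ : μ = l j := by
        by_contra h4
        exact hj (h3 j h4)
      have hxs : x = Pi.single j (x j) := by
        ext k
        by_cases hk : k = j
        · subst hk
          simp
        · rw [Pi.single_eq_of_ne hk]
          exact h3 k fun h4 => hk (h.strictAnti.injective (h4.symm.trans hμ))
      have h4 : (fun k => Real.exp (l k * t) * x k) = Real.exp (μ * t) • x := by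
        rw [hxs]
        ext k
        by_cases hk : k = j
        · subst hk
          simp [hμ]
        · simp [Pi.single_eq_of_ne hk]
      rw [h4, modelForm_smul (Real.exp_pos _)]
      refine mul_pos (by positivity) ?_
      rw [hxs, modelForm_single] at hy ⊢
      exact (modelTerm_pos_iff hj).1.2 ((modelTerm_pos_iff hj).2.1 hy)
  isAhead j r hr hmem := by
    simp only [mem_ofPred_eq] at hmem
    rw [h.mulVec_col, modelForm_single] at hmem
    exact (modelTerm_pos_iff hr).2.1 hmem
  mem_of_isAhead j r hr hmem := by
    simp only [mem_ofPred_eq]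
    rw [h.mulVec_col, modelForm_single]
    exact (modelTerm_pos_iff hr).1.2 hmem

open RaySphere

/-- A continuous map to the nonzero vectors of coordinates that meets each ray of a set of rays
exactly once is a homeomorphism onto that set. -/
theorem IsEigenbasis.nonempty_homeomorph (h : IsEigenbasis c l V W) {Z : Type*}
    [TopologicalSpace Z] [CompactSpace Z] (f : Z → Fin n → ℝ) (hf : Continuous f)
    (h0 : ∀ z, f z ≠ 0) {Y : Set (Fin n → ℝ)}
    (hY : ∀ r : ℝ, 0 < r → ∀ x, r • x ∈ Y ↔ x ∈ Y) (hfY : ∀ z, f z ∈ Y)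
    (hinj : ∀ z z' (r : ℝ), 0 < r → f z = r • f z' → z = z')
    (hsurj : ∀ x ∈ Y, x ≠ 0 → ∃ z, ∃ r : ℝ, 0 < r ∧ f z = r • x) :
    Nonempty ({y : RaySphere n | W.mulVec y.1 ∈ Y} ≃ₜ Z) := by
  have hV0 : ∀ z, V.mulVec (f z) ≠ 0 := fun z hz => h0 z <| by
    rw [← h.mulVec_mulVec' (f z), hz, Matrix.mulVec_zero]
  have hW : ∀ z, W.mulVec (ofNeZero _ (hV0 z)).1 ∈ Y := fun z => by
    simp only [ofNeZero]
    rw [Matrix.mulVec_smul, h.mulVec_mulVec', hY _ (inv_pos.2 (sum_abs_pos (hV0 z)))]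
    exact hfY z
  let g : Z → {y : RaySphere n | W.mulVec y.1 ∈ Y} := fun z => ⟨ofNeZero _ (hV0 z), hW z⟩
  have gc : Continuous g := (continuous_ofNeZero (by fun_prop) hV0).subtype_mk _
  have inj : Function.Injective g := fun z z' hzz => by
    obtain ⟨r, hr, hr'⟩ := (ofNeZero_eq_iff (hV0 z) (hV0 z')).1 (congrArg Subtype.val hzz)
    refine hinj z z' r hr ?_
    rw [← h.mulVec_mulVec' (f z), hr', Matrix.mulVec_smul, h.mulVec_mulVec']
  have surj : Function.Surjective g := fun y => by
    obtain ⟨z, r, hr, hz⟩ := hsurj _ y.2 (h.mulVec_ne_zero y.1.ne_zero)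
    refine ⟨z, Subtype.ext ?_⟩
    have h1 : V.mulVec (f z) = r • y.1.1 := by
      rw [hz, Matrix.mulVec_smul, h.mulVec_mulVec]
    have h2 := ofNeZero_smul y.1 hr (h1 ▸ hV0 z)
    simp only [g]
    rw [← h2, ofNeZero_eq_iff]
    exact ⟨1, one_pos, by rw [one_smul, h1]⟩
  exact ⟨(gc.homeoOfEquivCompactToT2 (f := Equiv.ofBijective g ⟨inj, surj⟩)).symm⟩

/-- With three eigenvalues above the threshold and five below it, the section of the model region
is a product of spheres. -/
theorem nonempty_homeomorph_sphere_prod_sphere {c : Fin 8 → Fin 8 → ℝ} {l : Fin 8 → ℝ}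
    {V W : Matrix (Fin 8) (Fin 8) ℝ} (h : IsEigenbasis c l V W)
    (hl : ∀ j : Fin 8, if j.val < 3 then μ < l j else l j < μ) :
    Nonempty ({y : RaySphere 8 | y.1 ∈ {y | 0 ≤ modelForm l μ (W.mulVec y)} \
        {y | 0 < modelForm l μ (W.mulVec y)}} ≃ₜ
      Metric.sphere (0 : EuclideanSpace ℝ (Fin 5)) 1 ×
        Metric.sphere (0 : EuclideanSpace ℝ (Fin 3)) 1) := by
  have hform : ∀ x : Fin 8 → ℝ, modelForm l μ x = x 0 ^ 2 + x 1 ^ 2 + x 2 ^ 2 -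
      (x 3 ^ 2 + x 4 ^ 2 + x 5 ^ 2 + x 6 ^ 2 + x 7 ^ 2) := fun x => by
    have h1 : ∀ j : Fin 8, modelTerm μ (l j) (x j) =
        if j.val < 3 then x j ^ 2 else - x j ^ 2 := fun j => by
      have := hl j
      unfold modelTerm
      split_ifs at this with h2
      · rw [if_pos this, if_pos h2]
      · rw [if_neg this.not_gt, if_neg this.ne', if_neg h2]
    simp only [modelForm, h1, Fin.sum_univ_eight]
    norm_num
    ring
  have hset : {y : RaySphere 8 | y.1 ∈ {y | 0 ≤ modelForm l μ (W.mulVec y)} \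
        {y | 0 < modelForm l μ (W.mulVec y)}} =
      {y : RaySphere 8 | W.mulVec y.1 ∈ {x | modelForm l μ x = 0}} := by
    ext y
    simp only [Set.mem_sdiff, mem_ofPred_eq, not_lt]
    exact ⟨fun h => le_antisymm h.2 h.1, fun h => ⟨h.ge, h.le⟩⟩
  rw [hset]
  have hsq5 : ∀ p : EuclideanSpace ℝ (Fin 5), p ∈ Metric.sphere 0 1 ↔
      p 0 ^ 2 + p 1 ^ 2 + p 2 ^ 2 + p 3 ^ 2 + p 4 ^ 2 = 1 := fun p => by
    rw [mem_sphere_zero_iff_norm, EuclideanSpace.norm_eq, Real.sqrt_eq_one]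
    simp [Fin.sum_univ_five]
  have hsq3 : ∀ p : EuclideanSpace ℝ (Fin 3), p ∈ Metric.sphere 0 1 ↔
      p 0 ^ 2 + p 1 ^ 2 + p 2 ^ 2 = 1 := fun p => by
    rw [mem_sphere_zero_iff_norm, EuclideanSpace.norm_eq, Real.sqrt_eq_one]
    simp [Fin.sum_univ_three]
  refine h.nonempty_homeomorph (fun z => ![z.2.1 0, z.2.1 1, z.2.1 2, z.1.1 0, z.1.1 1, z.1.1 2,
    z.1.1 3, z.1.1 4]) ?_ ?_ ?_ ?_ ?_ ?_
  · refine continuous_pi fun j => ?_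
    fin_cases j <;> simp <;> fun_prop
  · intro z hz
    have h2 := (hsq3 _).1 z.2.2
    have h3 := fun j => congrFun hz j
    have e0 := h3 0
    have e1 := h3 1
    have e2 := h3 2
    simp at e0 e1 e2
    simp [e0, e1, e2] at h2
  · intro r hr x
    simp only [mem_ofPred_eq, modelForm_smul hr]
    simp [hr.ne']
  · intro z
    have h2 := (hsq3 _).1 z.2.2
    have h3 := (hsq5 _).1 z.1.2
    simp only [mem_ofPred_eq, hform]
    simp
    linarith
  · intro z z' r hr hzz
    have h2 := (hsq3 _).1 z.2.2
    have h2' := (hsq3 _).1 z'.2.2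
    have h3 := fun j => congrFun hzz j
    have e0 := h3 0
    have e1 := h3 1
    have e2 := h3 2
    have e3 := h3 3
    have e4 := h3 4
    have e5 := h3 5
    have e6 := h3 6
    have e7 := h3 7
    simp at e0 e1 e2 e3 e4 e5 e6 e7
    have hr1 : r = 1 := by
      rw [e0, e1, e2] at h2
      have : r ^ 2 = 1 := by linear_combination h2 - r ^ 2 * h2'
      nlinarith
    subst hr1
    simp only [one_mul] at *
    refine Prod.ext (Subtype.ext ?_) (Subtype.ext ?_)
    · ext j
      fin_cases j <;> assumption
    · ext j
      fin_cases j <;> assumption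
  · intro x hx hx0
    simp only [mem_ofPred_eq, hform] at hx
    have hpos : 0 < x 0 ^ 2 + x 1 ^ 2 + x 2 ^ 2 := by
      by_contra hcon
      apply hx0
      ext j
      fin_cases j <;> simp <;> nlinarith [sq_nonneg (x 0), sq_nonneg (x 1), sq_nonneg (x 2),
        sq_nonneg (x 3), sq_nonneg (x 4), sq_nonneg (x 5), sq_nonneg (x 6), sq_nonneg (x 7)]
    obtain ⟨r, hr⟩ : ∃ r, r = (Real.sqrt (x 0 ^ 2 + x 1 ^ 2 + x 2 ^ 2))⁻¹ := ⟨_, rfl⟩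
    have hr0 : 0 < r := hr ▸ inv_pos.2 (Real.sqrt_pos.2 hpos)
    have hr2 : r ^ 2 * (x 0 ^ 2 + x 1 ^ 2 + x 2 ^ 2) = 1 := by
      rw [hr, inv_pow, Real.sq_sqrt hpos.le, inv_mul_cancel₀ hpos.ne']
    refine ⟨(⟨!₂[r * x 3, r * x 4, r * x 5, r * x 6, r * x 7], ?_⟩,
      ⟨!₂[r * x 0, r * x 1, r * x 2], ?_⟩), r, hr0, ?_⟩
    · rw [hsq5]
      simp
      linear_combination hr2 - r ^ 2 * hx
    · rw [hsq3]
      simp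
      linear_combination hr2
    · ext j
      fin_cases j <;> simp

/-- With two eigenvalues above the threshold, one equal to it and four below it, the model region
is a ball. The homeomorphism uses the two blocks of coordinates without the middle one, rescaled so
that the middle coordinate is determined by its signed square. -/
theorem nonempty_homeomorph_closedBall {c : Fin 7 → Fin 7 → ℝ} {l : Fin 7 → ℝ}
    {V W : Matrix (Fin 7) (Fin 7) ℝ} (h : IsEigenbasis c l V W)
    (hl : ∀ j : Fin 7, if j.val < 2 then μ < l j else if j.val = 2 then μ = l j else l j < μ) :
    Nonempty ({y : RaySphere 7 | y.1 ∈ {y | 0 ≤ modelForm l μ (W.mulVec y)}} ≃ₜ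
      Metric.closedBall (0 : EuclideanSpace ℝ (Fin 6)) 1) := by
  have hform : ∀ x : Fin 7 → ℝ, modelForm l μ x = x 0 ^ 2 + x 1 ^ 2 + x 2 * |x 2| -
      (x 3 ^ 2 + x 4 ^ 2 + x 5 ^ 2 + x 6 ^ 2) := fun x => by
    have h1 : ∀ j : Fin 7, modelTerm μ (l j) (x j) = if j.val < 2 then x j ^ 2 else
        if j.val = 2 then x j * |x j| else - x j ^ 2 := fun j => by
      have := hl j
      unfold modelTerm
      split_ifs at this with h2 h3
      · rw [if_pos this, if_pos h2]
      · rw [if_neg this.not_lt, if_pos this, if_neg h2, if_pos h3]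
      · rw [if_neg this.not_gt, if_neg this.ne', if_neg h2, if_neg h3]
    simp only [modelForm, h1, Fin.sum_univ_seven]
    norm_num
    ring
  have hball : ∀ p : EuclideanSpace ℝ (Fin 6), p ∈ Metric.closedBall 0 1 ↔
      p 0 ^ 2 + p 1 ^ 2 + p 2 ^ 2 + p 3 ^ 2 + p 4 ^ 2 + p 5 ^ 2 ≤ 1 := fun p => by
    rw [mem_closedBall_zero_iff, EuclideanSpace.norm_eq, Real.sqrt_le_one]
    simp [Fin.sum_univ_six]
  -- the inverse of `s ↦ s * |s|`
  obtain ⟨q, hq⟩ : ∃ q : ℝ → ℝ, q = fun s => Real.sqrt s - Real.sqrt (-s) := ⟨_, rfl⟩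
  have qc : Continuous q := by rw [hq]; fun_prop
  have hq1 : ∀ s, q s * |q s| = s := fun s => by
    rw [hq]
    rcases le_total 0 s with hs | hs
    · simp only [Real.sqrt_eq_zero_of_nonpos (neg_nonpos.2 hs), sub_zero]
      rw [abs_of_nonneg (Real.sqrt_nonneg s), Real.mul_self_sqrt hs]
    · simp only [Real.sqrt_eq_zero_of_nonpos hs, zero_sub, abs_neg]
      rw [abs_of_nonneg (Real.sqrt_nonneg _), neg_mul, Real.mul_self_sqrt (neg_nonneg.2 hs),
        neg_neg]
  have hinj : ∀ a b : ℝ, a * |a| = b * |b| → a = b := fun a b hab => by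
    rcases le_total 0 a with ha | ha <;> rcases le_total 0 b with hb | hb <;>
      simp only [abs_of_nonneg, abs_of_nonpos, ha, hb] at hab
    · nlinarith
    · have h1 : a = 0 := by nlinarith
      have h2 : b = 0 := by nlinarith
      rw [h1, h2]
    · have h1 : a = 0 := by nlinarith
      have h2 : b = 0 := by nlinarith
      rw [h1, h2]
    · nlinarith
  refine h.nonempty_homeomorph (Y := {x | 0 ≤ modelForm l μ x})
    (fun z => ![z.1 0, z.1 1, q (1 - 2 * (z.1 0 ^ 2 + z.1 1 ^ 2)), z.1 2, z.1 3,
      z.1 4, z.1 5]) ?_ ?_ ?_ ?_ ?_ ?_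
  · refine continuous_pi fun j => ?_
    fin_cases j <;> simp <;> fun_prop
  · intro z hz
    have e0 := congrFun hz 0
    have e1 := congrFun hz 1
    have e2 := congrFun hz 2
    simp at e0 e1 e2
    have h1 := hq1 (1 - 2 * (z.1 0 ^ 2 + z.1 1 ^ 2))
    rw [e2, e0, e1] at h1
    norm_num at h1
  · intro r hr x
    simp only [mem_ofPred_eq, modelForm_smul hr]
    exact mul_nonneg_iff_of_pos_left (by positivity)
  · intro z
    have h1 := (hball _).1 z.2
    have h2 := hq1 (1 - 2 * (z.1 0 ^ 2 + z.1 1 ^ 2))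
    simp only [mem_ofPred_eq, hform]
    simp
    linarith
  · intro z z' r hr hzz
    have h2 := hq1 (1 - 2 * (z.1 0 ^ 2 + z.1 1 ^ 2))
    have h2' := hq1 (1 - 2 * (z'.1 0 ^ 2 + z'.1 1 ^ 2))
    have e0 := congrFun hzz 0
    have e1 := congrFun hzz 1
    have e2 := congrFun hzz 2
    have e3 := congrFun hzz 3
    have e4 := congrFun hzz 4
    have e5 := congrFun hzz 5
    have e6 := congrFun hzz 6
    simp at e0 e1 e2 e3 e4 e5 e6
    have hr1 : r = 1 := by
      rw [e2, abs_mul, abs_of_pos hr, e0, e1] at h2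
      have : r ^ 2 = 1 := by linear_combination h2 - r ^ 2 * h2'
      nlinarith
    subst hr1
    simp only [one_mul] at *
    refine Subtype.ext ?_
    ext j
    fin_cases j <;> assumption
  · intro x hx hx0
    simp only [mem_ofPred_eq, hform] at hx
    -- the form that has the value `1` on the image of the ball
    obtain ⟨D, hD⟩ : ∃ D, D = 2 * (x 0 ^ 2 + x 1 ^ 2) + x 2 * |x 2| := ⟨_, rfl⟩
    have hpos : 0 < D := by
      by_contra hcon
      have hc2 : x 2 * |x 2| ≤ 0 := by nlinarith [sq_nonneg (x 0), sq_nonneg (x 1)]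
      have z0 : x 0 ^ 2 = 0 := by
        nlinarith [sq_nonneg (x 0), sq_nonneg (x 1), sq_nonneg (x 2),
        sq_nonneg (x 3), sq_nonneg (x 4), sq_nonneg (x 5), sq_nonneg (x 6)]
      have z1 : x 1 ^ 2 = 0 := by
        nlinarith [sq_nonneg (x 0), sq_nonneg (x 1), sq_nonneg (x 2),
        sq_nonneg (x 3), sq_nonneg (x 4), sq_nonneg (x 5), sq_nonneg (x 6)]
      have z2 : x 2 = 0 := hinj _ _ (by
        rw [zero_mul]
        nlinarith [sq_nonneg (x 0), sq_nonneg (x 1), sq_nonneg (x 2),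
        sq_nonneg (x 3), sq_nonneg (x 4), sq_nonneg (x 5), sq_nonneg (x 6)])
      rw [z0, z1, z2] at hx
      apply hx0
      ext j
      fin_cases j <;> simp <;> nlinarith [sq_nonneg (x 0), sq_nonneg (x 1), sq_nonneg (x 2),
        sq_nonneg (x 3), sq_nonneg (x 4), sq_nonneg (x 5), sq_nonneg (x 6)]
    obtain ⟨r, hr⟩ : ∃ r, r = (Real.sqrt D)⁻¹ := ⟨_, rfl⟩
    have hr0 : 0 < r := hr ▸ inv_pos.2 (Real.sqrt_pos.2 hpos)
    have hr2 : r ^ 2 * D = 1 := by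
      rw [hr, inv_pow, Real.sq_sqrt hpos.le, inv_mul_cancel₀ hpos.ne']
    refine ⟨⟨!₂[r * x 0, r * x 1, r * x 3, r * x 4, r * x 5, r * x 6], ?_⟩, r, hr0, ?_⟩
    · rw [hball]
      simp
      rw [hD] at hr2
      nlinarith [mul_nonneg (sq_nonneg r) hx]
    · have hmid : q (1 - 2 * ((r * x 0) ^ 2 + (r * x 1) ^ 2)) = r * x 2 := by
        apply hinj
        rw [hq1, abs_mul, abs_of_pos hr0]
        rw [hD] at hr2
        linear_combination -hr2
      ext j
      fin_cases j <;> simp [hmid]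

end SignWord

/-! ### Switches and Krawtchouk vectors -/

namespace SignWord

variable {n : ℕ}

/-- The number of places where consecutive letters of a sign word differ. -/
def switches (ε : Fin (n + 1) → Bool) : ℕ :=
  (Finset.univ.filter fun i : Fin n => ε i.castSucc ≠ ε i.succ).card

theorem isVariation_switches : IsVariation (switches (n := n)) := by
  intro ε i j hij
  by_cases he : ε i = ε j
  · rw [← he, Function.update_eq_self]
  rcases hij with h | h
  · -- a new change before place `i` is paid for by the change after it
    have hi : i.val < n := by omega
    have hij : i ≠ j := fun h' => by subst h'; omega
    refine Finset.card_le_card_of_injOn (fun k => if k.succ = i then ⟨i, hi⟩ else k) ?_ ?_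
    · intro k hk
      simp only [Finset.coe_filter, Finset.mem_univ, true_and, mem_ofPred_eq] at hk ⊢
      split_ifs with h1
      · have e1 : (Fin.castSucc ⟨i, hi⟩ : Fin (n + 1)) = i := Fin.ext rfl
        have e2 : (Fin.succ ⟨i, hi⟩ : Fin (n + 1)) = j := Fin.ext (by simp; omega)
        rwa [e1, e2]
      · by_cases h2 : k.castSucc = i
        · have h3 : k.succ = j := Fin.ext (by rw [← h, ← h2]; simp)
          rw [h2, h3, Function.update_self, Function.update_of_ne hij.symm] at hk
          exact absurd rfl hk
        · rwa [Function.update_of_ne h1, Function.update_of_ne h2] at hk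
    · intro k hk k' hk' hkk
      simp only [Finset.coe_filter, Finset.mem_univ, true_and, mem_ofPred_eq] at hk hk' hkk
      have key : ∀ k : Fin n, Function.update ε i (ε j) k.castSucc ≠
          Function.update ε i (ε j) k.succ → k ≠ ⟨i, hi⟩ := by
        rintro k hk rfl
        have e1 : (Fin.castSucc ⟨i, hi⟩ : Fin (n + 1)) = i := Fin.ext rfl
        have e2 : (Fin.succ ⟨i, hi⟩ : Fin (n + 1)) = j := Fin.ext (by simp; omega)
        rw [e1, e2, Function.update_self, Function.update_of_ne hij.symm] at hk
        exact hk rfl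
      split_ifs at hkk with h1 h2 h2
      · exact Fin.succ_injective _ (h1.trans h2.symm)
      · exact absurd hkk.symm (key k' hk')
      · exact absurd hkk (key k hk)
      · exact hkk
  · have hj : j.val < n := by omega
    have hij : i ≠ j := fun h' => by subst h'; omega
    have e1 : (Fin.castSucc ⟨j, hj⟩ : Fin (n + 1)) = j := Fin.ext rfl
    have e2 : (Fin.succ ⟨j, hj⟩ : Fin (n + 1)) = i := Fin.ext (by simp; omega)
    refine Finset.card_le_card_of_injOn (fun k => if k.castSucc = i then ⟨j, hj⟩ else k) ?_ ?_
    · intro k hk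
      simp only [Finset.coe_filter, Finset.mem_univ, true_and, mem_ofPred_eq] at hk ⊢
      split_ifs with h1
      · rw [e1, e2]
        exact Ne.symm he
      · by_cases h2 : k.succ = i
        · have h3 : k.castSucc = j := Fin.ext (by
            have := congrArg Fin.val h2
            simp only [Fin.val_succ, Fin.val_castSucc] at this ⊢
            omega)
          rw [h2, h3, Function.update_self, Function.update_of_ne hij.symm] at hk
          exact absurd rfl hk
        · rwa [Function.update_of_ne h1, Function.update_of_ne h2] at hk
    · intro k hk k' hk' hkk
      simp only [Finset.coe_filter, Finset.mem_univ, true_and, mem_ofPred_eq] at hk hk' hkk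
      have key : ∀ k : Fin n, Function.update ε i (ε j) k.castSucc ≠
          Function.update ε i (ε j) k.succ → k ≠ ⟨j, hj⟩ := by
        rintro k hk rfl
        rw [e1, e2, Function.update_self, Function.update_of_ne hij.symm] at hk
        exact hk rfl
      split_ifs at hkk with h1 h2 h2
      · exact Fin.castSucc_injective _ (h1.trans h2.symm)
      · exact absurd hkk.symm (key k' hk')
      · exact absurd hkk (key k hk)
      · exact hkk

/-- The switches of a word that is preceded by the letter `true`. -/
def switchesFromTrue (ε : Fin n → Bool) : ℕ := switches (Fin.cons true ε : Fin (n + 1) → Bool)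

theorem isVariation_switchesFromTrue : IsVariation (switchesFromTrue (n := n)) := by
  intro ε i j hij
  have h1 := isVariation_switches (Fin.cons true ε) i.succ j.succ
    (by simpa [Adj] using hij)
  rwa [Fin.cons_succ, ← Fin.cons_update] at h1

/-- The coefficient of `x ^ i` in `(1 + x) ^ (n - 1 - j) * (1 - x) ^ j`. -/
def krawtchouk (n : ℕ) : Matrix (Fin n) (Fin n) ℤ := fun i j =>
  ∑ k ∈ Finset.range (i + 1), (-1) ^ k * (j.val.choose k * (n - 1 - j.val).choose (i - k) : ℕ)

/-- The entries next to the diagonal of the tridiagonal matrix by which the operator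
`f ↦ (n - 1) x f + (1 - x ^ 2) f'` acts on coefficients. -/
def kacCoeff (n : ℕ) (i j : Fin n) : ℤ := if j < i then n - i else i + 1

/-- The eigenvalues of that operator. -/
def kacEigenvalue (n : ℕ) (j : Fin n) : ℤ := n - 1 - 2 * j

theorem isEigenbasis_krawtchouk
    (h1 : krawtchouk n * krawtchouk n = (2 ^ (n - 1) : ℤ) • (1 : Matrix (Fin n) (Fin n) ℤ))
    (h2 : ∀ i j : Fin n, ∑ k with Adj i k, kacCoeff n i k * krawtchouk n k j =
      kacEigenvalue n j * krawtchouk n i j) :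
    IsEigenbasis (fun i j => (kacCoeff n i j : ℝ)) (fun j => (kacEigenvalue n j : ℝ))
      ((krawtchouk n).map (Int.cast : ℤ → ℝ))
      (((2 : ℝ) ^ (n - 1))⁻¹ • (krawtchouk n).map (Int.cast : ℤ → ℝ)) where
  pos i j _ := by
    have hi := i.2
    rw [Int.cast_pos]
    unfold kacCoeff
    split_ifs <;> omega
  mul_eq_one := by
    rw [Matrix.mul_smul]
    have h3 := congrArg (fun M : Matrix (Fin n) (Fin n) ℤ => M.map (Int.castRingHom ℝ)) h1
    simp only [Matrix.map_mul] at h3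
    have h4 : ((2 ^ (n - 1) : ℤ) • (1 : Matrix (Fin n) (Fin n) ℤ)).map (Int.castRingHom ℝ) =
        ((2 : ℝ) ^ (n - 1)) • (1 : Matrix (Fin n) (Fin n) ℝ) := by
      ext i j
      rw [Matrix.map_apply, Matrix.smul_apply, Matrix.smul_apply, Matrix.one_apply,
        Matrix.one_apply]
      split_ifs <;> simp
    rw [h4] at h3
    have h5 : (krawtchouk n).map (Int.castRingHom ℝ) = (krawtchouk n).map (Int.cast : ℤ → ℝ) := rfl
    rw [← h5, h3, smul_smul, inv_mul_cancel₀ (by positivity), one_smul]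
  eigen j := by
    ext i
    rw [tridiag_apply]
    simp only [Matrix.map_apply, Pi.smul_apply, smul_eq_mul]
    exact_mod_cast h2 i j
  strictAnti i j hij := by
    simp only [kacEigenvalue]
    have : i.val < j.val := hij
    have h3 : (i.val : ℝ) < j.val := by exact_mod_cast this
    push_cast
    linarith

/-- The integral version of `sgn`. -/
def sgnInt (b : Bool) : ℤ := if b then 1 else -1

theorem compat_krawtchouk_iff (ε : Fin n → Bool) (b : Bool) (j : Fin n) :
    Compat ε (sgn b • fun i => (krawtchouk n).map (Int.cast : ℤ → ℝ) i j) ↔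
      ∀ i, 0 ≤ sgnInt (ε i) * (sgnInt b * krawtchouk n i j) := by
  have h : ∀ b, sgn b = (sgnInt b : ℝ) := fun b => by cases b <;> simp [sgnInt]
  refine forall_congr' fun i => ?_
  simp only [h, Pi.smul_apply, smul_eq_mul, Matrix.map_apply]
  exact_mod_cast Iff.rfl

theorem krawtchouk_eight_mul_self :
    krawtchouk 8 * krawtchouk 8 = (2 ^ (8 - 1) : ℤ) • (1 : Matrix (Fin 8) (Fin 8) ℤ) := by
  ext i j
  revert i j
  decide +kernel

theorem krawtchouk_seven_mul_self :
    krawtchouk 7 * krawtchouk 7 = (2 ^ (7 - 1) : ℤ) • (1 : Matrix (Fin 7) (Fin 7) ℤ) := by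
  ext i j
  revert i j
  decide +kernel

theorem krawtchouk_eight_eigen : ∀ i j : Fin 8, ∑ k with Adj i k,
    kacCoeff 8 i k * krawtchouk 8 k j = kacEigenvalue 8 j * krawtchouk 8 i j := by
  decide +kernel

theorem krawtchouk_seven_eigen : ∀ i j : Fin 7, ∑ k with Adj i k,
    kacCoeff 7 i k * krawtchouk 7 k j = kacEigenvalue 7 j * krawtchouk 7 i j := by
  decide +kernel

/-- The `j`-th Krawtchouk vector has `j` sign changes, so that it has at most two exactly for
`j < 3`, whichever signs are chosen for its zero entries. -/
theorem switches_krawtchouk_eight : ∀ (ε : Fin 8 → Bool) (b : Bool) (j : Fin 8),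
    (∀ i, 0 ≤ sgnInt (ε i) * (sgnInt b * krawtchouk 8 i j)) → (switches ε ≤ 2 ↔ j.val < 3) := by
  decide +kernel

/-- Preceded by a positive entry, the `j`-th Krawtchouk vector and its negative have `j` and `j + 1`
sign changes. -/
theorem switches_krawtchouk_seven : ∀ (ε : Fin 7 → Bool) (b : Bool) (j : Fin 7),
    (∀ i, 0 ≤ sgnInt (ε i) * (sgnInt b * krawtchouk 7 i j)) →
      (switchesFromTrue ε ≤ 2 ↔ j.val < 2 ∨ j.val = 2 ∧ b = true) := by
  decide +kernel

/-- The eigenvalues `7 - 2 * j` with `j < 3` are those above the threshold `2`. -/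
theorem nonempty_homeomorph_lowSet_eight :
    Nonempty ({y : RaySphere 8 | y.1 ∈ lowSet switches 2 \ lowInterior switches 2} ≃ₜ
      Metric.sphere (0 : EuclideanSpace ℝ (Fin 5)) 1 ×
        Metric.sphere (0 : EuclideanSpace ℝ (Fin 3)) 1) := by
  have h := isEigenbasis_krawtchouk krawtchouk_eight_mul_self krawtchouk_eight_eigen
  have hahead : ∀ (j : Fin 8) (b : Bool),
      IsAhead (fun j => (kacEigenvalue 8 j : ℝ)) 2 j (sgn b) ↔ j.val < 3 := fun j b => by
    have h1 : (2 : ℝ) = ((2 : ℤ) : ℝ) := by norm_num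
    simp only [IsAhead, h1, Int.cast_lt, Int.cast_inj, kacEigenvalue]
    constructor
    · rintro (h2 | ⟨h2, -⟩) <;> omega
    · intro h2
      left
      push_cast
      omega
  have hA := isAdapted_lowSet h isVariation_switches (μ := 2) (m := 2)
    (fun j b ⟨ε, hε, hm⟩ => (hahead j b).2
      ((switches_krawtchouk_eight ε b j ((compat_krawtchouk_iff ε b j).1 hε)).1 hm))
    (fun j b hj ε hε =>
      (switches_krawtchouk_eight ε b j ((compat_krawtchouk_iff ε b j).1 hε)).2 ((hahead j b).1 hj))
  obtain ⟨f⟩ := hA.nonempty_homeomorph_section (isAdapted_modelForm h 2) h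
  obtain ⟨g⟩ := nonempty_homeomorph_sphere_prod_sphere (μ := 2) h (fun j => by
    fin_cases j <;> norm_num [kacEigenvalue])
  exact ⟨f.trans g⟩

/-- The eigenvalues `6 - 2 * j` with `j < 2` are above the threshold `2`, and the one with `j = 2`
is equal to it. -/
theorem nonempty_homeomorph_lowSet_seven :
    Nonempty ({y : RaySphere 7 | y.1 ∈ lowSet switchesFromTrue 2} ≃ₜ
      Metric.closedBall (0 : EuclideanSpace ℝ (Fin 6)) 1) := by
  have h := isEigenbasis_krawtchouk krawtchouk_seven_mul_self krawtchouk_seven_eigen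
  have hahead : ∀ (j : Fin 7) (b : Bool),
      IsAhead (fun j => (kacEigenvalue 7 j : ℝ)) 2 j (sgn b) ↔
        j.val < 2 ∨ j.val = 2 ∧ b = true := fun j b => by
    have h1 : (2 : ℝ) = ((2 : ℤ) : ℝ) := by norm_num
    have h3 : 0 < sgn b ↔ b = true := by cases b <;> simp
    simp only [IsAhead, h1, Int.cast_lt, Int.cast_inj, kacEigenvalue, h3]
    refine or_congr ?_ (and_congr_left fun _ => ?_) <;> push_cast <;> omega
  have hA := isAdapted_lowSet h isVariation_switchesFromTrue (μ := 2) (m := 2)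
    (fun j b ⟨ε, hε, hm⟩ => (hahead j b).2
      ((switches_krawtchouk_seven ε b j ((compat_krawtchouk_iff ε b j).1 hε)).1 hm))
    (fun j b hj ε hε =>
      (switches_krawtchouk_seven ε b j ((compat_krawtchouk_iff ε b j).1 hε)).2
        ((hahead j b).1 hj))
  obtain ⟨f⟩ := hA.nonempty_homeomorph (isAdapted_modelForm h 2) h
  obtain ⟨g⟩ := nonempty_homeomorph_closedBall (μ := 2) h (fun j => by
    fin_cases j <;> norm_num [kacEigenvalue])
  exact ⟨f.trans g⟩

end SignWord

/-! ### Realizations in the boundary of a cross polytope -/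

namespace PreAbstractSimplicialComplex

open SignWord

variable {n : ℕ} {V : Type*} [DecidableEq V]

/-- The vertices `e (k, b)` for which the `k`-th coordinate of `y` has the sign `b`. -/
noncomputable def signSupport (e : Fin n × Bool → V) (y : Fin n → ℝ) : Finset V :=
  (Finset.univ.filter fun p : Fin n × Bool => 0 < sgn p.2 * y p.1).image e

theorem mem_signSupport {e : Fin n × Bool → V} (he : Function.Injective e) {y : Fin n → ℝ}
    {p : Fin n × Bool} : e p ∈ signSupport e y ↔ 0 < sgn p.2 * y p.1 := by
  rw [signSupport, he.mem_finset_image]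
  simp

/-- A complex whose vertices are labelled as those of a cross polytope and whose faces contain no
pair of opposite vertices is realized in the boundary of the cross polytope. -/
theorem nonempty_homeomorph_realization [Fintype V] (L : PreAbstractSimplicialComplex V)
    (e : Fin n × Bool → V) (he : Function.Injective e)
    (hrange : ∀ s ∈ L.faces, ∀ v ∈ s, v ∈ range e)
    (hanti : ∀ s ∈ L.faces, ∀ k, e (k, true) ∈ s → e (k, false) ∉ s) :
    Nonempty (L.realization ≃ₜ {y : RaySphere n | signSupport e y.1 ∈ L.faces}) := by
  let F : (V → ℝ) → Fin n → ℝ := fun x k => x (e (k, true)) - x (e (k, false))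
  let G : (Fin n → ℝ) → V → ℝ := fun y v =>
    ∑ p, if e p = v then max (sgn p.2 * y p.1) 0 else 0
  have hF : Continuous F := by fun_prop
  have hG : Continuous G := by
    refine continuous_pi fun v => continuous_finsetSum _ fun p _ => ?_
    split_ifs <;> fun_prop
  have hGe : ∀ y p, G y (e p) = max (sgn p.2 * y p.1) 0 := fun y p => by
    simp [G, he.eq_iff]
  have hG0 : ∀ y v, v ∉ range e → G y v = 0 := fun y v hv => by
    refine Finset.sum_eq_zero fun p _ => if_neg fun h => hv ⟨p, h⟩
  have hsum : ∀ x : V → ℝ, (∀ v, v ∉ range e → x v = 0) →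
      ∑ v, x v = ∑ k, (x (e (k, true)) + x (e (k, false))) := fun x hx => by
    have h1 : ∑ v, x v = ∑ p, x (e p) := by
      rw [← Finset.sum_image (s := Finset.univ) (f := x) (g := e) he.injOn]
      refine (Finset.sum_subset (Finset.subset_univ _) fun v _ hv => hx v fun h => hv ?_).symm
      obtain ⟨p, rfl⟩ := h
      exact Finset.mem_image_of_mem e (Finset.mem_univ p)
    rw [h1, Fintype.sum_prod_type]
    simp
  have hx0 : ∀ x ∈ L.realization, ∀ v, v ∉ range e → x v = 0 := by
    rintro x ⟨-, s, hs, hxs⟩ v hv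
    by_contra h
    exact hv (hrange s hs v (hxs v h))
  -- one of the two barycentric coordinates of opposite vertices vanishes
  have hzero : ∀ x ∈ L.realization, ∀ k, x (e (k, true)) = 0 ∨ x (e (k, false)) = 0 := by
    rintro x ⟨-, s, hs, hxs⟩ k
    by_contra! h
    exact hanti s hs k (hxs _ h.1) (hxs _ h.2)
  have hGF : ∀ x ∈ L.realization, G (F x) = x := by
    intro x hx
    ext v
    by_cases hv : v ∈ range e
    · obtain ⟨⟨k, b⟩, rfl⟩ := hv
      rw [hGe]
      have h1 := hx.1.1 (e (k, true))
      have h2 := hx.1.1 (e (k, false))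
      cases b <;> rcases hzero x hx k with h | h <;> simp [F, h, h1, h2]
    · rw [hG0 _ _ hv, hx0 x hx v hv]
  have hFG : ∀ y, F (G y) = y := fun y => by
    ext k
    simp only [F, hGe, sgn_true, sgn_false]
    rcases le_total 0 (y k) with h | h
    · rw [max_eq_left (by linarith), max_eq_right (by linarith)]
      ring
    · rw [max_eq_right (by linarith), max_eq_left (by linarith)]
      ring
  have hGnonneg : ∀ y v, 0 ≤ G y v := fun y v => Finset.sum_nonneg fun p _ => by
    split_ifs
    · exact le_max_right _ _
    · exact le_rfl
  have hGsum : ∀ y, ∑ v, G y v = ∑ k, |y k| := fun y => by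
    rw [hsum _ (hG0 y)]
    refine Finset.sum_congr rfl fun k _ => ?_
    simp only [hGe, sgn_true, sgn_false]
    rcases le_total 0 (y k) with h | h
    · rw [max_eq_left (by linarith), max_eq_right (by linarith), abs_of_nonneg h]
      ring
    · rw [max_eq_right (by linarith), max_eq_left (by linarith), abs_of_nonpos h]
      ring
  have hGsupp : ∀ y v, G y v ≠ 0 ↔ v ∈ signSupport e y := fun y v => by
    by_cases hv : v ∈ range e
    · obtain ⟨p, rfl⟩ := hv
      rw [mem_signSupport he, hGe, ← not_le, not_iff_not, max_eq_right_iff]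
    · refine iff_of_false (fun h => h (hG0 y v hv)) fun h => hv ?_
      obtain ⟨p, -, rfl⟩ := Finset.mem_image.1 h
      exact ⟨p, rfl⟩
  have hsupp : ∀ x ∈ L.realization, signSupport e (F x) ∈ L.faces := by
    intro x hx
    have h1 : ∀ v, x v ≠ 0 ↔ v ∈ signSupport e (F x) := fun v => by
      rw [← hGsupp, hGF x hx]
    obtain ⟨⟨-, hx1⟩, s, hs, hxs⟩ := hx
    refine (L.isRelLowerSet_faces hs).2 (fun v hv => hxs v ((h1 v).2 hv)) ?_
    by_contra h2
    rw [Finset.not_nonempty_iff_eq_empty] at h2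
    have h3 : ∀ v, x v = 0 := fun v => by
      by_contra h
      have := (h1 v).1 h
      rw [h2] at this
      exact Finset.notMem_empty v this
    simp [h3] at hx1
  have hnorm : ∀ x ∈ L.realization, ∑ k, |F x k| = 1 := fun x hx => by
    rw [← hGsum, hGF x hx]
    exact hx.1.2
  exact ⟨{
    toFun := fun x => ⟨⟨F x, hnorm x x.2⟩, hsupp x x.2⟩
    invFun := fun y => ⟨G y.1.1, ⟨fun v => hGnonneg _ v, (hGsum _).trans y.1.2⟩,
      signSupport e y.1.1, y.2, fun v hv => (hGsupp _ v).1 hv⟩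
    left_inv := fun x => Subtype.ext (hGF x x.2)
    right_inv := fun y => Subtype.ext (Subtype.ext (hFG y.1.1))
    continuous_toFun := by
      refine Continuous.subtype_mk (Continuous.subtype_mk ?_ _) _
      exact hF.comp continuous_subtype_val
    continuous_invFun := by
      refine Continuous.subtype_mk ?_ _
      exact hG.comp (continuous_subtype_val.comp continuous_subtype_val) }⟩

/-! ### Complexes of sign words -/

/-- The face `s` of the cross polytope lies in the facet given by the sign word `ε`. -/
def InFacet {ι : Type*} (ε : ι → Bool) (s : Finset (ι × Bool)) : Prop := ∀ v ∈ s, ε v.1 = v.2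

theorem InFacet.mono {ι : Type*} {ε : ι → Bool} {s t : Finset (ι × Bool)} (h : InFacet ε t)
    (hst : s ⊆ t) : InFacet ε s := fun v hv => h v (hst hv)

/-- The subcomplex of the boundary of the cross polytope generated by a set of sign words. -/
def ofWords {ι : Type*} (A : Set (ι → Bool)) : PreAbstractSimplicialComplex (ι × Bool) where
  faces := {s | s.Nonempty ∧ ∃ ε ∈ A, InFacet ε s}
  isRelLowerSet_faces := by
    rintro s ⟨hs, ε, hε, h⟩
    exact ⟨hs, fun t hts ht => ⟨ht, ε, hε, h.mono hts⟩⟩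

/-- The words on eight letters with at most two switches. -/
def lowWords : Set (Fin 8 → Bool) := {ε | switches ε ≤ 2}

/-- The complex generated by the words with at most two switches: a solid tube around a
two-dimensional sphere in the boundary of the cross polytope. -/
def tube : PreAbstractSimplicialComplex (Fin 8 × Bool) := ofWords lowWords

/-- The common boundary of `tube` and the complex generated by the remaining words. -/
def tubeBoundary : PreAbstractSimplicialComplex (Fin 8 × Bool) :=
  ofWords lowWords ⊓ ofWords lowWordsᶜ

theorem mem_tubeBoundary {s : Finset (Fin 8 × Bool)} :
    s ∈ tubeBoundary.faces ↔ s.Nonempty ∧ (∃ ε, switches ε ≤ 2 ∧ InFacet ε s) ∧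
      ∃ ε, ¬ switches ε ≤ 2 ∧ InFacet ε s :=
  ⟨fun h => ⟨h.1.1, h.1.2, h.2.2⟩, fun h => ⟨⟨h.1, h.2.1⟩, ⟨h.1, h.2.2⟩⟩⟩

theorem InFacet.not_mem {ι : Type*} {ε : ι → Bool} {s : Finset (ι × Bool)} (h : InFacet ε s)
    {v : ι × Bool} (hv : v ∈ s) : (v.1, !v.2) ∉ s := fun hv' => by
  have h1 := h v hv
  have h2 := h _ hv'
  simp only at h2
  rw [h1] at h2
  revert h2
  cases v.2 <;> simp

theorem compat_iff_inFacet {n : ℕ} (ε : Fin n → Bool) (y : Fin n → ℝ) :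
    Compat ε y ↔ InFacet ε (signSupport id y) := by
  constructor
  · rintro h ⟨k, b⟩ hv
    have h1 := (mem_signSupport Function.injective_id (p := (k, b))).1 hv
    have h2 := h k
    simp only at h1 ⊢
    refine eq_of_mul_pos (r := y k) (fun h0 => ?_) h2 h1.le
    rw [h0, mul_zero] at h1
    exact lt_irrefl _ h1
  · intro h k
    by_contra! hk
    have h1 : ((k, !ε k) : Fin n × Bool) ∈ signSupport id y :=
      (mem_signSupport Function.injective_id (p := (k, !ε k))).2 (by
        simp only [sgn_not]
        linarith)
    have h2 := h _ h1
    simp only at h2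
    revert h2
    cases ε k <;> simp

theorem triangulates_tubeBoundary :
    tubeBoundary.Triangulates (Metric.sphere (0 : EuclideanSpace ℝ (Fin 5)) 1 ×
      Metric.sphere (0 : EuclideanSpace ℝ (Fin 3)) 1) := by
  obtain ⟨f⟩ := nonempty_homeomorph_realization tubeBoundary id Function.injective_id
    (fun s _ v _ => ⟨v, rfl⟩) (fun s hs k hk => by
      obtain ⟨-, ⟨ε, -, h⟩, -⟩ := mem_tubeBoundary.1 hs
      exact h.not_mem hk)
  obtain ⟨g⟩ := nonempty_homeomorph_lowSet_eight
  have hset : {y : RaySphere 8 | signSupport id y.1 ∈ tubeBoundary.faces} =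
      {y : RaySphere 8 | y.1 ∈ lowSet switches 2 \ lowInterior switches 2} := by
    ext y
    simp only [mem_ofPred_eq, mem_tubeBoundary, ← compat_iff_inFacet, Set.mem_sdiff, lowSet,
      lowInterior, not_forall, exists_prop]
    constructor
    · rintro ⟨-, ⟨ε, h1, h2⟩, ε', h3, h4⟩
      exact ⟨⟨ε, h2, h1⟩, ε', h4, h3⟩
    · rintro ⟨⟨ε, h2, h1⟩, ε', h4, h3⟩
      refine ⟨?_, ⟨ε, h1, h2⟩, ε', h3, h4⟩
      obtain ⟨k, hk⟩ := Function.ne_iff.1 y.ne_zero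
      rcases lt_or_gt_of_ne hk with hk | hk
      · exact ⟨(k, false), (mem_signSupport Function.injective_id (p := (k, false))).2
          (by simpa using hk)⟩
      · exact ⟨(k, true), (mem_signSupport Function.injective_id (p := (k, true))).2
          (by simpa using hk)⟩
  rw [hset] at f
  exact ⟨f.trans g⟩

/-! ### Vertex links -/

/-- Having at most two switches is a cyclic property, since the number of switches around the cycle
is even and exceeds the number along the path by at most one. -/
theorem switches_rotate : ∀ (ξ : Fin 8 → Bool) (i : Fin 8) (b : Bool),
    switches (fun j => (!b) ^^ ξ (j - i)) ≤ 2 ↔ switches ξ ≤ 2 := by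
  decide +kernel

/-- The labelling of the vertices away from the axis of `v`, rotated and reflected so that `v` has
the label `(0, true)`. -/
def linkLabel (v : Fin 8 × Bool) (p : Fin 7 × Bool) : Fin 8 × Bool :=
  (v.1 + p.1.succ, (!v.2) ^^ p.2)

theorem linkLabel_injective (v : Fin 8 × Bool) : Function.Injective (linkLabel v) := by
  rintro ⟨k, b⟩ ⟨k', b'⟩ h
  simp only [linkLabel, Prod.mk.injEq, add_right_inj, Bool.xor_right_inj] at h
  exact Prod.ext (Fin.succ_injective _ h.1) h.2

theorem mem_range_linkLabel {v w : Fin 8 × Bool} (h : w.1 ≠ v.1) : w ∈ range (linkLabel v) := by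
  obtain ⟨k, hk⟩ := Fin.exists_succ_eq.2 (sub_ne_zero.2 h)
  refine ⟨(k, (!v.2) ^^ w.2), Prod.ext ?_ ?_⟩
  · simp [linkLabel, hk]
  · simp [linkLabel]

theorem link_subset {v : Fin 8 × Bool} {s : Finset (Fin 8 × Bool)} (hs : s ∈ (tube.link v).faces)
    {w : Fin 8 × Bool} (hw : w ∈ s) : w.1 ≠ v.1 := fun h => by
  obtain ⟨-, hv, -, ε, -, hε⟩ := hs
  have h1 := hε v (Finset.mem_insert_self _ _)
  have h2 := hε w (Finset.mem_insert_of_mem hw)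
  apply hv
  rwa [show v = w from Prod.ext h.symm (by rw [← h1, ← h2, h])]

theorem signSupport_mem_link_iff (v : Fin 8 × Bool) (y : RaySphere 7) :
    signSupport (linkLabel v) y.1 ∈ (tube.link v).faces ↔ y.1 ∈ lowSet switchesFromTrue 2 := by
  have hinj := linkLabel_injective v
  have hfacet : ∀ η : Fin 7 → Bool, Compat η y.1 ↔
      InFacet (fun j => (!v.2) ^^ (Fin.cons true η : Fin 8 → Bool) (j - v.1))
        (insert v (signSupport (linkLabel v) y.1)) := fun η => by
    rw [compat_iff_inFacet]
    constructor
    · intro h w hw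
      rcases Finset.mem_insert.1 hw with rfl | hw
      · simp
      · obtain ⟨p, hp, rfl⟩ := Finset.mem_image.1 hw
        have h1 := h p (Finset.mem_image.2 ⟨p, hp, rfl⟩)
        simp [linkLabel, h1]
    · intro h p hp
      have hp' := (mem_signSupport Function.injective_id (p := p)).1 hp
      have h1 := h (linkLabel v p) (Finset.mem_insert_of_mem ((mem_signSupport hinj).2 hp'))
      simpa [linkLabel] using h1
  constructor
  · rintro ⟨-, -, -, ε, hε, h⟩
    have h1 := h v (Finset.mem_insert_self _ _)
    have h2 : ε = fun j => (!v.2) ^^ (Fin.cons true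
        (fun k : Fin 7 => (!v.2) ^^ ε (v.1 + k.succ)) : Fin 8 → Bool) (j - v.1) := by
      ext j
      rcases Fin.eq_zero_or_eq_succ (j - v.1) with h3 | ⟨k, h3⟩
      · rw [h3, Fin.cons_zero, sub_eq_zero.1 h3, h1]
        simp
      · rw [h3, Fin.cons_succ, ← h3]
        simp
    refine ⟨_, (hfacet _).2 (h2 ▸ h), ?_⟩
    rw [switchesFromTrue, ← switches_rotate _ v.1 v.2, ← h2]
    exact hε
  · rintro ⟨η, hη, hm⟩
    refine ⟨?_, fun hv => ?_, ⟨v, Finset.mem_insert_self _ _⟩, _,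
      (switches_rotate _ v.1 v.2).2 hm, (hfacet η).1 hη⟩
    · obtain ⟨k, hk⟩ := Function.ne_iff.1 y.ne_zero
      rcases lt_or_gt_of_ne hk with hk | hk
      · exact ⟨_, (mem_signSupport hinj (p := (k, false))).2 (by simpa using hk)⟩
      · exact ⟨_, (mem_signSupport hinj (p := (k, true))).2 (by simpa using hk)⟩
    · obtain ⟨p, -, hp⟩ := Finset.mem_image.1 hv
      have := congrArg Prod.fst hp
      simp [linkLabel] at this

theorem triangulates_link_tube (v : Fin 8 × Bool) :
    (tube.link v).Triangulates (Metric.closedBall (0 : EuclideanSpace ℝ (Fin 6)) 1) := by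
  obtain ⟨f⟩ := nonempty_homeomorph_realization (tube.link v) (linkLabel v)
    (linkLabel_injective v) (fun s hs w hw => mem_range_linkLabel (link_subset hs hw))
    (fun s hs k hk hk' => by
      obtain ⟨-, -, -, ε, -, hε⟩ := hs
      have h1 := hε _ (Finset.mem_insert_of_mem hk)
      have h2 := hε _ (Finset.mem_insert_of_mem hk')
      simp only [linkLabel] at h1 h2
      rw [h1] at h2
      simp at h2)
  obtain ⟨g⟩ := nonempty_homeomorph_lowSet_seven
  have hset : {y : RaySphere 7 | signSupport (linkLabel v) y.1 ∈ (tube.link v).faces} =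
      {y : RaySphere 7 | y.1 ∈ lowSet switchesFromTrue 2} :=
    Set.ext fun y => signSupport_mem_link_iff v y
  rw [hset] at f
  exact ⟨f.trans g⟩

end PreAbstractSimplicialComplex

/-! ### Patterns of signs -/

namespace SignWord

variable {n : ℕ}

theorem switches_cons (a : Bool) (ε : Fin (n + 1) → Bool) :
    switches (Fin.cons a ε : Fin (n + 2) → Bool) = (if a ≠ ε 0 then 1 else 0) + switches ε := by
  rw [switches, Fin.card_filter_univ_succ]
  have h : (Fin.cons a ε : Fin (n + 2) → Bool) (Fin.castSucc 0) = a := rfl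
  rw [h, Fin.cons_succ]
  split_ifs
  · rw [add_comm]
    rfl
  · rw [zero_add]
    rfl

/-- The least number of switches of a word that begins with `a`, followed by letters
prescribed by `x` where `x` is not `none`: free letters repeat the one before. -/
def minSwitches : (n : ℕ) → Bool → (Fin n → Option Bool) → ℕ
  | 0, _, _ => 0
  | n + 1, a, x =>
    match x 0 with
    | none => minSwitches n a fun i => x i.succ
    | some b => (if a = b then 0 else 1) + minSwitches n b fun i => x i.succ

/-- The greatest number of switches of a word that begins with `a`, followed by letters
prescribed by `x` where `x` is not `none`: free letters differ from the one before. -/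
def maxSwitches : (n : ℕ) → Bool → (Fin n → Option Bool) → ℕ
  | 0, _, _ => 0
  | n + 1, a, x =>
    match x 0 with
    | none => 1 + maxSwitches n (!a) fun i => x i.succ
    | some b => (if a = b then 0 else 1) + maxSwitches n b fun i => x i.succ

/-- The word `ε` has the letters prescribed by `x`. -/
def Extends (ε : Fin n → Bool) (x : Fin n → Option Bool) : Prop := ∀ i b, x i = some b → ε i = b

/-- The number of prescribed letters. -/
def patternSize : (n : ℕ) → (Fin n → Option Bool) → ℕ
  | 0, _ => 0
  | n + 1, x =>
    match x 0 with
    | none => patternSize n fun i => x i.succ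
    | some _ => 1 + patternSize n fun i => x i.succ

theorem patternSize_eq_card (x : Fin n → Option Bool) :
    patternSize n x = (Finset.univ.filter fun i => (x i).isSome).card := by
  induction n with
  | zero => rfl
  | succ n ih =>
    rw [Fin.card_filter_univ_succ, patternSize]
    rcases x 0 with - | b
    · simp [ih]
    · simp [ih, add_comm]

theorem minSwitches_le_patternSize (a : Bool) (x : Fin n → Option Bool) :
    minSwitches n a x ≤ patternSize n x := by
  induction n generalizing a with
  | zero => rfl
  | succ n ih =>
    unfold minSwitches patternSize
    rcases x 0 with - | b
    · exact ih a _
    · have := ih b fun i => x i.succ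
      simp only
      split_ifs <;> omega

theorem exists_minSwitches_lt (x : Fin n → Option Bool) (hx : 0 < patternSize n x) :
    ∃ a, minSwitches n a x < patternSize n x := by
  induction n with
  | zero => exact absurd hx (lt_irrefl 0)
  | succ n ih =>
    unfold minSwitches
    unfold patternSize at hx ⊢
    revert hx
    rcases x 0 with - | b <;> intro hx
    · exact ih _ hx
    · refine ⟨b, ?_⟩
      have := minSwitches_le_patternSize b fun i => x i.succ
      simp only [if_true]
      omega

theorem le_maxSwitches_add (a : Bool) (x : Fin n → Option Bool) :
    n ≤ maxSwitches n a x + patternSize n x := by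
  induction n generalizing a with
  | zero => exact Nat.zero_le _
  | succ n ih =>
    unfold maxSwitches patternSize
    rcases x 0 with - | b
    · have := ih (!a) fun i => x i.succ
      simp only
      omega
    · have := ih b fun i => x i.succ
      simp only
      omega

theorem exists_lt_maxSwitches_add (x : Fin n → Option Bool) (hx : 0 < patternSize n x) :
    ∃ a, n < maxSwitches n a x + patternSize n x := by
  induction n with
  | zero => exact absurd hx (lt_irrefl 0)
  | succ n ih =>
    unfold maxSwitches
    unfold patternSize at hx ⊢
    revert hx
    rcases x 0 with - | b <;> intro hx
    · obtain ⟨a, ha⟩ := ih _ hx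
      refine ⟨!a, ?_⟩
      simp only [Bool.not_not]
      omega
    · refine ⟨!b, ?_⟩
      have := le_maxSwitches_add b fun i => x i.succ
      have h : (if (!b) = b then 0 else 1) = 1 := by cases b <;> rfl
      simp only [h]
      omega

/-- Changing the letter in front of a pattern changes the least number of switches by at most
one. -/
theorem minSwitches_le_succ (a b : Bool) (x : Fin n → Option Bool) :
    minSwitches n a x ≤ (if a = b then 0 else 1) + minSwitches n b x := by
  induction n generalizing a b with
  | zero => simp [minSwitches]
  | succ n ih =>
    unfold minSwitches
    rcases x 0 with - | d
    · exact ih _ _ _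
    · cases a <;> cases b <;> cases d <;> simp <;> omega

/-- Changing the letter in front of a pattern changes the greatest number of switches by at most
one. -/
theorem maxSwitches_le_succ (a b : Bool) (x : Fin n → Option Bool) :
    maxSwitches n a x ≤ (if a = b then 0 else 1) + maxSwitches n b x := by
  induction n generalizing a b with
  | zero => simp [maxSwitches]
  | succ n ih =>
    unfold maxSwitches
    rcases x 0 with - | d
    · have := ih (!a) (!b) fun i => x i.succ
      cases a <;> cases b <;> simp at * <;> omega
    · cases a <;> cases b <;> cases d <;> simp <;> omega

theorem switches_bounds (a : Bool) {ε : Fin n → Bool} {x : Fin n → Option Bool}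
    (h : Extends ε x) :
    minSwitches n a x ≤ switches (Fin.cons a ε : Fin (n + 1) → Bool) ∧
      switches (Fin.cons a ε : Fin (n + 1) → Bool) ≤ maxSwitches n a x := by
  induction n generalizing a with
  | zero => simp [minSwitches, maxSwitches, switches]
  | succ n ih =>
    have h1 := ih (ε 0) (ε := fun i => ε i.succ) (x := fun i => x i.succ) fun i b => h i.succ b
    have h2 : (Fin.cons (ε 0) fun i : Fin n => ε i.succ) = ε := Fin.cons_self_tail ε
    rw [h2] at h1
    rw [switches_cons]
    unfold minSwitches maxSwitches
    rcases hx : x 0 with - | d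
    · have h3 := minSwitches_le_succ a (ε 0) fun i => x i.succ
      have h4 := maxSwitches_le_succ (ε 0) (!a) fun i => x i.succ
      generalize ε 0 = d at *
      revert h1 h3 h4
      cases a <;> cases d <;> simp <;> omega
    · have h3 := h 0 d hx
      rw [h3] at h1 ⊢
      simp only [ne_eq, ite_not]
      omega

theorem exists_switches_eq (a : Bool) (x : Fin n → Option Bool) :
    (∃ ε, Extends ε x ∧ switches (Fin.cons a ε : Fin (n + 1) → Bool) = minSwitches n a x) ∧
      ∃ ε, Extends ε x ∧ switches (Fin.cons a ε : Fin (n + 1) → Bool) = maxSwitches n a x := by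
  induction n generalizing a with
  | zero =>
    exact ⟨⟨Fin.elim0, fun i => i.elim0, rfl⟩, ⟨Fin.elim0, fun i => i.elim0, rfl⟩⟩
  | succ n ih =>
    have key : ∀ (d : Bool) (ε : Fin n → Bool), Extends ε (fun i => x i.succ) →
        (∀ b, x 0 = some b → d = b) → Extends (Fin.cons d ε : Fin (n + 1) → Bool) x := by
      intro d ε h1 h2 i
      refine Fin.cases ?_ (fun i => ?_) i
      · exact h2
      · exact h1 i
    unfold minSwitches maxSwitches
    rcases hx : x 0 with - | d
    · obtain ⟨⟨ε, h1, h2⟩, -⟩ := ih a fun i => x i.succ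
      obtain ⟨-, ⟨ε', h1', h2'⟩⟩ := ih (!a) fun i => x i.succ
      refine ⟨⟨Fin.cons a ε, key _ _ h1 (by simp [hx]), ?_⟩,
        ⟨Fin.cons (!a) ε', key _ _ h1' (by simp [hx]), ?_⟩⟩
      · rw [switches_cons, h2]
        simp
      · rw [switches_cons, h2']
        cases a <;> simp
    · obtain ⟨⟨ε, h1, h2⟩, ⟨ε', h1', h2'⟩⟩ := ih d fun i => x i.succ
      refine ⟨⟨Fin.cons d ε, key _ _ h1 (by simp [hx]), ?_⟩,
        ⟨Fin.cons d ε', key _ _ h1' (by simp [hx]), ?_⟩⟩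
      · rw [switches_cons, h2]
        simp
      · rw [switches_cons, h2']
        simp

theorem exists_switches_le_iff (x : Fin (n + 1) → Option Bool) (m : ℕ) :
    (∃ ε, switches ε ≤ m ∧ Extends ε x) ↔ ∃ a, minSwitches (n + 1) a x ≤ m := by
  constructor
  · rintro ⟨ε, hm, hε⟩
    refine ⟨ε 0, (switches_bounds (ε 0) hε).1.trans ?_⟩
    rw [switches_cons]
    simpa using hm
  · rintro ⟨a, ha⟩
    obtain ⟨⟨ε, hε, h⟩, -⟩ := exists_switches_eq a x
    rw [switches_cons] at h
    exact ⟨ε, by omega, hε⟩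

/-- The letter in front of a word may differ from the first letter, which adds a switch. -/
theorem exists_lt_switches_iff (x : Fin (n + 1) → Option Bool) (m : ℕ) :
    (∃ ε, ¬ switches ε ≤ m ∧ Extends ε x) ↔ ∃ a, m + 2 ≤ maxSwitches (n + 1) a x := by
  constructor
  · rintro ⟨ε, hm, hε⟩
    refine ⟨!ε 0, le_trans ?_ (switches_bounds (!ε 0) hε).2⟩
    rw [switches_cons]
    simp
    omega
  · rintro ⟨a, ha⟩
    obtain ⟨-, ε, hε, h⟩ := exists_switches_eq a x
    rw [switches_cons] at h
    refine ⟨ε, ?_, hε⟩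
    split_ifs at h <;> omega

end SignWord

namespace PreAbstractSimplicialComplex

open SignWord

/-- The set of vertices of the cross polytope given by a pattern of signs. -/
def ofPattern {n : ℕ} (x : Fin n → Option Bool) : Finset (Fin n × Bool) :=
  Finset.univ.filter fun v => x v.1 = some v.2

theorem mem_ofPattern {n : ℕ} {x : Fin n → Option Bool} {v : Fin n × Bool} :
    v ∈ ofPattern x ↔ x v.1 = some v.2 := by
  simp [ofPattern]

theorem ofPattern_injective {n : ℕ} : Function.Injective (ofPattern (n := n)) := by
  intro x y h
  ext i b
  have := Finset.ext_iff.1 h (i, b)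
  rwa [mem_ofPattern, mem_ofPattern] at this

theorem card_ofPattern {n : ℕ} (x : Fin n → Option Bool) :
    (ofPattern x).card = patternSize n x := by
  rw [patternSize_eq_card]
  refine Finset.card_bij (fun v _ => v.1) ?_ ?_ ?_
  · intro v hv
    simp [mem_ofPattern.1 hv]
  · intro v hv w hw h
    have h1 := mem_ofPattern.1 hv
    have h2 := mem_ofPattern.1 hw
    rw [h, h2] at h1
    exact Prod.ext h (Option.some_injective _ h1).symm
  · intro i hi
    obtain ⟨b, hb⟩ := Option.isSome_iff_exists.1 (Finset.mem_filter.1 hi).2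
    exact ⟨(i, b), mem_ofPattern.2 hb, rfl⟩

theorem exists_ofPattern_eq {n : ℕ} {s : Finset (Fin n × Bool)}
    (hs : ∀ v ∈ s, (v.1, !v.2) ∉ s) : ∃ x, ofPattern x = s := by
  refine ⟨fun i => if (i, true) ∈ s then some true else if (i, false) ∈ s then some false
    else none, ?_⟩
  ext ⟨i, b⟩
  rw [mem_ofPattern]
  have h1 := hs (i, true)
  simp only [Bool.not_true] at h1
  simp only
  cases b <;> split_ifs with h2 h3 <;> simp_all

theorem inFacet_ofPattern_iff {n : ℕ} {x : Fin n → Option Bool} {ε : Fin n → Bool} :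
    InFacet ε (ofPattern x) ↔ Extends ε x :=
  ⟨fun h i b hx => h (i, b) (mem_ofPattern.2 hx), fun h _ hv => h _ _ (mem_ofPattern.1 hv)⟩

theorem mem_tubeBoundary_iff {x : Fin 8 → Option Bool} :
    ofPattern x ∈ tubeBoundary.faces ↔ 0 < patternSize 8 x ∧
      (∃ a, minSwitches 8 a x ≤ 2) ∧ ∃ a, 4 ≤ maxSwitches 8 a x := by
  rw [mem_tubeBoundary, ← Finset.card_pos, card_ofPattern, ← exists_switches_le_iff,
    ← exists_lt_switches_iff]
  simp only [inFacet_ofPattern_iff]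

theorem tubeBoundary_not_mem {s : Finset (Fin 8 × Bool)} (hs : s ∈ tubeBoundary.faces) :
    ∀ v ∈ s, (v.1, !v.2) ∉ s := by
  intro v hv
  obtain ⟨-, ⟨ε, -, h⟩, -⟩ := mem_tubeBoundary.1 hs
  exact h.not_mem hv

/-- Faces are counted as sign patterns whose least and greatest numbers of switches, after a free
leading letter, lie on both sides of the bound. -/
theorem faceCount_tubeBoundary (i : ℕ) : tubeBoundary.faceCount i =
    (Finset.univ.filter fun x : Fin 8 → Option Bool => patternSize 8 x = i + 1 ∧
      (∃ a, minSwitches 8 a x ≤ 2) ∧ ∃ a, 4 ≤ maxSwitches 8 a x).card := by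
  have h1 : {s | s ∈ tubeBoundary.faces ∧ s.card = i + 1} = ((Finset.univ.filter
      fun x : Fin 8 → Option Bool => patternSize 8 x = i + 1 ∧
      (∃ a, minSwitches 8 a x ≤ 2) ∧ ∃ a, 4 ≤ maxSwitches 8 a x).image ofPattern :
        Set (Finset (Fin 8 × Bool))) := by
    ext s
    simp only [mem_ofPred_eq, Finset.coe_image, Finset.coe_filter, Finset.mem_univ, true_and,
      Set.mem_image]
    constructor
    · rintro ⟨hs, hc⟩
      obtain ⟨x, rfl⟩ := exists_ofPattern_eq (tubeBoundary_not_mem hs)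
      rw [card_ofPattern] at hc
      exact ⟨x, ⟨hc, (mem_tubeBoundary_iff.1 hs).2⟩, rfl⟩
    · rintro ⟨x, ⟨hc, hx⟩, rfl⟩
      exact ⟨mem_tubeBoundary_iff.2 ⟨by omega, hx⟩, (card_ofPattern x).trans hc⟩
  rw [faceCount, h1, Set.ncard_coe_finset, Finset.card_image_of_injective _ ofPattern_injective]

/-- Counting words by their first letter; it splits a count into parts small enough for
evaluation. -/
theorem card_filter_fin_cons {α : Type*} [Fintype α] [DecidableEq α] {n : ℕ}
    (p : (Fin (n + 1) → α) → Prop) [DecidablePred p] :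
    (Finset.univ.filter p).card =
      ∑ a, (Finset.univ.filter fun x : Fin n → α => p (Fin.cons a x : Fin (n + 1) → α)).card := by
  simp only [Finset.card_filter]
  rw [← (Fin.consEquiv fun _ => α).sum_comp, Fintype.sum_prod_type]
  rfl

theorem fVector_tubeBoundary : tubeBoundary.fVector 6 = ![16, 112, 448, 980, 1232, 840, 240] := by
  funext i
  simp only [fVector, faceCount_tubeBoundary, card_filter_fin_cons (n := 7),
    card_filter_fin_cons (n := 6), card_filter_fin_cons (n := 5)]
  revert i
  decide +kernel

end PreAbstractSimplicialComplex

/-! ### Boundaries of vertex links -/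

namespace PreAbstractSimplicialComplex

open SignWord

/-- Changing one word into another letter by letter leaves a set of words at some step. -/
theorem exists_boundary_word {ι : Type*} [Fintype ι] [DecidableEq ι] {A : Set (ι → Bool)}
    {ε ε' : ι → Bool} (hε : ε ∈ A) (hε' : ε' ∉ A) :
    ∃ δ ∈ A, ∃ p, ε p ≠ ε' p ∧ (∀ i, ε i = ε' i → δ i = ε i) ∧
      Function.update δ p (!δ p) ∉ A := by
  obtain ⟨d, hd⟩ : ∃ d, d = (Finset.univ.filter fun i => ε i ≠ ε' i).card := ⟨_, rfl⟩
  induction d generalizing ε with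
  | zero =>
    have h : ε = ε' := by
      ext i
      by_contra h
      have := Finset.card_eq_zero.1 hd.symm
      exact Finset.notMem_empty i (this ▸ Finset.mem_filter.2 ⟨Finset.mem_univ i, by simpa using h⟩)
    exact absurd (h ▸ hε) hε'
  | succ d ih =>
    obtain ⟨p, hp⟩ : (Finset.univ.filter fun i => ε i ≠ ε' i).Nonempty := by
      rw [← Finset.card_pos]
      omega
    have hne := (Finset.mem_filter.1 hp).2
    by_cases h : Function.update ε p (!ε p) ∈ A
    · have hup : (!ε p) = ε' p := by
        revert hne
        cases ε p <;> cases ε' p <;> simp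
      have hcard : d = (Finset.univ.filter
          fun i => Function.update ε p (!ε p) i ≠ ε' i).card := by
        have : (Finset.univ.filter fun l => Function.update ε p (!ε p) l ≠ ε' l) =
            (Finset.univ.filter fun l => ε l ≠ ε' l).erase p := by
          ext l
          by_cases hl : l = p
          · subst hl
            simp [hup]
          · simp [hl]
        rw [this, Finset.card_erase_of_mem hp, ← hd]
        rfl
      obtain ⟨δ, hδ, q, hq, hδε, hδ'⟩ := ih h hcard
      have hqp : q ≠ p := fun h => by
        subst h
        rw [Function.update_self] at hq
        exact hq hup
      rw [Function.update_of_ne hqp] at hq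
      refine ⟨δ, hδ, q, hq, fun i hi => ?_, hδ'⟩
      have hip : i ≠ p := fun h => hne (h ▸ hi)
      have := hδε i (by rwa [Function.update_of_ne hip])
      rwa [Function.update_of_ne hip] at this
    · exact ⟨ε, hε, p, hne, fun _ _ => rfl, h⟩

/-- The facet of the cross polytope given by a sign word. -/
def facet {n : ℕ} (ε : Fin n → Bool) : Finset (Fin n × Bool) := Finset.univ.image fun i => (i, ε i)

theorem mem_facet {n : ℕ} {ε : Fin n → Bool} {v : Fin n × Bool} : v ∈ facet ε ↔ ε v.1 = v.2 := by
  simp only [facet, Finset.mem_image, Finset.mem_univ, true_and]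
  constructor
  · rintro ⟨i, rfl⟩
    rfl
  · intro h
    exact ⟨v.1, Prod.ext rfl h⟩

theorem card_facet {n : ℕ} (ε : Fin n → Bool) : (facet ε).card = n := by
  rw [facet, Finset.card_image_of_injective _ fun i j h => congrArg Prod.fst h, Finset.card_univ,
    Fintype.card_fin]

theorem inFacet_iff_subset {n : ℕ} {ε : Fin n → Bool} {s : Finset (Fin n × Bool)} :
    InFacet ε s ↔ s ⊆ facet ε :=
  ⟨fun h _ hv => mem_facet.2 (h _ hv), fun h _ hv => mem_facet.1 (h hv)⟩

theorem mem_link {V : Type*} [DecidableEq V] {K : PreAbstractSimplicialComplex V} {v : V}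
    {s : Finset V} : s ∈ (K.link v).faces ↔ s.Nonempty ∧ v ∉ s ∧ insert v s ∈ K.faces := Iff.rfl

/-- The link of a vertex in `tube` has as its boundary the link in `tubeBoundary`: a face is in the
boundary exactly if it extends to a word that leaves the set of words with at most two switches when
one letter is changed. -/
theorem boundary_link_tube (v : Fin 8 × Bool) :
    (tube.link v).boundary 6 = tubeBoundary.link v := by
  apply PreAbstractSimplicialComplex.ext
  ext s
  rw [mem_link, mem_tubeBoundary]
  constructor
  · rintro ⟨hs, t, ⟨-, hvt, ht⟩, hst, htc, u, ⟨-, -, -⟩, huniq⟩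
    obtain ⟨-, ε, hε, hεt⟩ := ht
    refine ⟨hs, fun h => hvt (hst h), ⟨v, Finset.mem_insert_self _ _⟩,
      ⟨ε, hε, hεt.mono (Finset.insert_subset_insert v hst)⟩, ?_⟩
    -- the only vertex of the facet that is missing from the codimension one face
    obtain ⟨w, hw⟩ : ∃ w, facet ε \ insert v t = {w} := by
      rw [← Finset.card_eq_one, Finset.card_sdiff_of_subset (inFacet_iff_subset.1 hεt),
        card_facet, Finset.card_insert_of_notMem hvt, htc]
    have hwF : w ∈ facet ε ∧ w ∉ insert v t := by
      rw [← Finset.mem_sdiff, hw]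
      exact Finset.mem_singleton_self w
    have hwε := mem_facet.1 hwF.1
    have hout : ∀ x ∈ insert v t, x.1 ≠ w.1 := fun x hx h => hwF.2 <| by
      rwa [show w = x from Prod.ext h.symm (by rw [← hwε, ← hεt x hx, h])]
    have hupd : InFacet (Function.update ε w.1 (!ε w.1)) (insert v t) := fun x hx => by
      rw [Function.update_of_ne (hout x hx)]
      exact hεt x hx
    refine ⟨_, fun hlow => ?_, hupd.mono (Finset.insert_subset_insert v hst)⟩
    -- a word of `tube` that contains the face gives the unique facet, so that both words agree
    -- at `w`
    have hface : ∀ δ : Fin 8 → Bool, switches δ ≤ 2 → InFacet δ (insert v t) →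
        (facet δ).erase v = u := fun δ hδ hδt => by
      have hvδ : v ∈ facet δ := mem_facet.2 (hδt v (Finset.mem_insert_self _ _))
      have hc : ((facet δ).erase v).card = 7 := by
        rw [Finset.card_erase_of_mem hvδ, card_facet]
      refine huniq _ ⟨⟨?_, Finset.notMem_erase _ _, ?_⟩, ?_, hc⟩
      · rw [← Finset.card_pos, hc]
        norm_num
      · rw [Finset.insert_erase hvδ]
        exact ⟨⟨v, hvδ⟩, δ, hδ, fun x hx => mem_facet.1 hx⟩
      · intro x hx
        exact Finset.mem_erase.2 ⟨fun h => hvt (h ▸ hx),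
          mem_facet.2 (hδt x (Finset.mem_insert_of_mem hx))⟩
    have h1 := (hface _ hε hεt).trans (hface _ hlow hupd).symm
    have h2 : w ∈ (facet ε).erase v :=
      Finset.mem_erase.2 ⟨fun h => hwF.2 (h ▸ Finset.mem_insert_self _ _), hwF.1⟩
    rw [h1] at h2
    have h3 := mem_facet.1 (Finset.mem_of_mem_erase h2)
    rw [Function.update_self, hwε] at h3
    simp at h3
  · rintro ⟨hs, hvs, -, ⟨ε, hε, hεs⟩, ε', hε', hεs'⟩
    obtain ⟨δ, hδ, p, hp, hδε, hδ'⟩ := exists_boundary_word (A := lowWords) hε hε'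
    have hδs : InFacet δ (insert v s) := fun x hx => by
      rw [hδε x.1 ((hεs x hx).trans (hεs' x hx).symm)]
      exact hεs x hx
    have hps : ∀ x ∈ insert v s, x.1 ≠ p := fun x hx h => hp <| by
      rw [← h]
      exact (hεs x hx).trans (hεs' x hx).symm
    have hvδ : v ∈ facet δ := mem_facet.2 (hδs v (Finset.mem_insert_self _ _))
    have hpδ : (p, δ p) ∈ facet δ := mem_facet.2 rfl
    have hvp : v ≠ (p, δ p) := fun h => hps v (Finset.mem_insert_self _ _) (congrArg Prod.fst h)
    have huc : ((facet δ).erase v).card = 7 := by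
      rw [Finset.card_erase_of_mem hvδ, card_facet]
    have htc : (((facet δ).erase v).erase (p, δ p)).card = 6 := by
      rw [Finset.card_erase_of_mem (Finset.mem_erase.2 ⟨hvp.symm, hpδ⟩), huc]
    have hlink : ∀ t : Finset (Fin 8 × Bool), t.Nonempty → t ⊆ (facet δ).erase v →
        t ∈ (tube.link v).faces := fun t ht hsub =>
      ⟨ht, fun h => Finset.notMem_erase v _ (hsub h), ⟨v, Finset.mem_insert_self _ _⟩, δ, hδ,
        inFacet_iff_subset.2 (Finset.insert_subset hvδ
          (hsub.trans (Finset.erase_subset _ _)))⟩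
    refine ⟨hs, ((facet δ).erase v).erase (p, δ p), hlink _ ?_ (Finset.erase_subset _ _), ?_, htc,
      (facet δ).erase v, ⟨hlink _ ?_ subset_rfl, Finset.erase_subset _ _, huc⟩, ?_⟩
    · rw [← Finset.card_pos, htc]
      norm_num
    · intro x hx
      refine Finset.mem_erase.2 ⟨fun h => ?_, Finset.mem_erase.2 ⟨fun h => hvs (h ▸ hx),
        mem_facet.2 (hδs x (Finset.mem_insert_of_mem hx))⟩⟩
      exact hps x (Finset.mem_insert_of_mem hx) (congrArg Prod.fst h)
    · rw [← Finset.card_pos, huc]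
      norm_num
    · rintro u ⟨⟨-, hvu, -, η, hη, hηu⟩, htu, huc'⟩
      have hu : insert v u = facet η := Finset.eq_of_subset_of_card_le
        (inFacet_iff_subset.1 hηu) (by rw [card_facet, Finset.card_insert_of_notMem hvu, huc'])
      have hagree : ∀ i, i ≠ p → η i = δ i := fun i hi => by
        have h1 : (i, δ i) ∈ insert v u := by
          by_cases h2 : (i, δ i) = v
          · rw [h2]
            exact Finset.mem_insert_self _ _
          · refine Finset.mem_insert_of_mem (htu (Finset.mem_erase.2 ⟨fun h => ?_,
              Finset.mem_erase.2 ⟨h2, mem_facet.2 rfl⟩⟩))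
            exact hi (congrArg Prod.fst h)
        exact hηu _ h1
      have hηp : η p = δ p := by
        by_contra h
        apply hδ'
        have : Function.update δ p (!δ p) = η := by
          ext i
          by_cases hi : i = p
          · subst hi
            revert h
            cases η i <;> cases δ i <;> simp
          · rw [Function.update_of_ne hi, hagree i hi]
        rw [this]
        exact hη
      have hηδ : η = δ := funext fun i => by
        by_cases hi : i = p
        · rw [hi, hηp]
        · exact hagree i hi
      rw [← hηδ, ← hu, Finset.erase_insert hvu]

theorem exists_switches_le_of_card {s : Finset (Fin 8 × Bool)} (hs : s.Nonempty)
    (hanti : ∀ v ∈ s, (v.1, !v.2) ∉ s) (hc : s.card ≤ 3) : ∃ ε, switches ε ≤ 2 ∧ InFacet ε s := by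
  obtain ⟨x, rfl⟩ := exists_ofPattern_eq hanti
  rw [← Finset.card_pos, card_ofPattern] at hs
  rw [card_ofPattern] at hc
  obtain ⟨a, ha⟩ := exists_minSwitches_lt x hs
  simp only [inFacet_ofPattern_iff]
  exact (exists_switches_le_iff x 2).2 ⟨a, show minSwitches 8 a x ≤ 2 by omega⟩

theorem exists_lt_switches_of_card {s : Finset (Fin 8 × Bool)} (hs : s.Nonempty)
    (hanti : ∀ v ∈ s, (v.1, !v.2) ∉ s) (hc : s.card ≤ 5) :
    ∃ ε, ¬ switches ε ≤ 2 ∧ InFacet ε s := by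
  obtain ⟨x, rfl⟩ := exists_ofPattern_eq hanti
  rw [← Finset.card_pos, card_ofPattern] at hs
  rw [card_ofPattern] at hc
  obtain ⟨a, ha⟩ := exists_lt_maxSwitches_add x hs
  simp only [inFacet_ofPattern_iff]
  exact (exists_lt_switches_iff x 2).2 ⟨a, show 4 ≤ maxSwitches 8 a x by omega⟩

theorem isStackedSphere_link_tubeBoundary (v : Fin 8 × Bool) :
    (tubeBoundary.link v).IsStackedSphere 2 5 := by
  refine ⟨tube.link v, ⟨by norm_num, triangulates_link_tube v, fun j hj s hs hc => ?_⟩,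
    boundary_link_tube v⟩
  rw [boundary_link_tube, mem_link, mem_tubeBoundary]
  obtain ⟨hne, hvs, hne', ε, hε, hεs⟩ := hs
  refine ⟨hne, hvs, hne', ⟨ε, hε, hεs⟩, exists_lt_switches_of_card hne' (fun w hw => hεs.not_mem hw)
    ?_⟩
  rw [Finset.card_insert_of_notMem hvs]
  omega

theorem hasDimension_tubeBoundary : tubeBoundary.HasDimension 6 := by
  constructor
  · have h : {s | s ∈ tubeBoundary.faces ∧ s.card = 6 + 1}.ncard = 240 :=
      congrFun fVector_tubeBoundary 6
    obtain ⟨s, hs, hc⟩ := Set.nonempty_of_ncard_ne_zero (h.trans_ne (by norm_num))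
    exact ⟨s, hs, hc⟩
  · intro s hs
    obtain ⟨-, ⟨ε, hε, h⟩, ε', hε', h'⟩ := mem_tubeBoundary.1 hs
    have h1 : s ⊆ facet ε := inFacet_iff_subset.1 h
    have h2 : s ⊆ facet ε' := inFacet_iff_subset.1 h'
    by_contra! hc
    have e1 := Finset.eq_of_subset_of_card_le h1 (by rw [card_facet]; omega)
    have e2 := Finset.eq_of_subset_of_card_le h2 (by rw [card_facet]; omega)
    apply hε'
    have : ε' = ε := funext fun i => by
      have h3 : (i, ε i) ∈ facet ε := mem_facet.2 rfl
      rw [← e1, e2] at h3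
      exact mem_facet.1 h3
    rwa [this]

theorem isCentrallySymmetric_tubeBoundary : tubeBoundary.IsCentrallySymmetric := by
  let σ : Equiv.Perm (Fin 8 × Bool) := (Equiv.refl _).prodCongr Equiv.boolNot
  have hσ : ∀ v, σ v = (v.1, !v.2) := fun v => rfl
  have hinv : Function.Involutive σ := fun v => by simp [hσ]
  have hneg : ∀ ε : Fin 8 → Bool, switches (fun i => !ε i) = switches ε := fun ε => by
    simp [switches]
  have hfacet : ∀ (ε : Fin 8 → Bool) s, InFacet ε s →
      InFacet (fun i => !ε i) (s.map σ.toEmbedding) := fun ε s h w hw => by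
    obtain ⟨v, hv, rfl⟩ := Finset.mem_map.1 hw
    simp only [Equiv.coe_toEmbedding, hσ, h v hv]
  have hmap : ∀ s ∈ tubeBoundary.faces, s.map σ.toEmbedding ∈ tubeBoundary.faces := fun s hs => by
    obtain ⟨hne, ⟨ε, hε, h⟩, ε', hε', h'⟩ := mem_tubeBoundary.1 hs
    exact mem_tubeBoundary.2 ⟨hne.map, ⟨_, (hneg ε).trans_le hε, hfacet ε s h⟩, _,
      fun hle => hε' ((hneg ε') ▸ hle), hfacet ε' s h'⟩
  refine ⟨σ, hinv, fun s => ⟨hmap s, fun h => ?_⟩, fun s hs h => ?_⟩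
  · have h1 := hmap _ h
    rw [Finset.map_map] at h1
    convert h1
    ext v
    constructor
    · intro hv
      exact Finset.mem_map.2 ⟨v, hv, hinv v⟩
    · intro hv
      obtain ⟨w, hw, rfl⟩ := Finset.mem_map.1 hv
      have : (σ.toEmbedding.trans σ.toEmbedding) w = w := hinv w
      rwa [this]
  · obtain ⟨v, hv⟩ := (mem_tubeBoundary.1 hs).1
    refine tubeBoundary_not_mem hs v hv ?_
    rw [← h]
    exact Finset.mem_map.2 ⟨v, hv, hσ v⟩

theorem isHamiltonianSubcomplex_tubeBoundary :
    IsHamiltonianSubcomplex 2 tubeBoundary (CrossPolytope.boundaryComplex 8) := by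
  constructor
  · intro s hs
    exact (CrossPolytope.spansProperFace_iff 8 s).2
      ⟨(mem_tubeBoundary.1 hs).1, tubeBoundary_not_mem hs⟩
  · intro s hs hc
    obtain ⟨hne, hanti⟩ := (CrossPolytope.spansProperFace_iff 8 s).1 hs
    exact mem_tubeBoundary.2 ⟨hne, exists_switches_le_of_card hne hanti hc,
      exists_lt_switches_of_card hne hanti (by omega)⟩

end PreAbstractSimplicialComplex

end

open PreAbstractSimplicialComplex in
theorem mainTheorem5 :
    ∃ M : PreAbstractSimplicialComplex (Fin 8 × Bool),
      M.Triangulates (Metric.sphere (0 : EuclideanSpace ℝ (Fin 5)) 1 ×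
        Metric.sphere (0 : EuclideanSpace ℝ (Fin 3)) 1) ∧
      M.IsCentrallySymmetric ∧
      M.fVector 6 = ![16, 112, 448, 980, 1232, 840, 240] ∧
      M.IsHamiltonianSubcomplex 2 (CrossPolytope.boundaryComplex 8) ∧
      M.InClassK 2 6 :=
  ⟨tubeBoundary, triangulates_tubeBoundary, isCentrallySymmetric_tubeBoundary,
    fVector_tubeBoundary, isHamiltonianSubcomplex_tubeBoundary, by norm_num,
    hasDimension_tubeBoundary, fun v _ => isStackedSphere_link_tubeBoundary v⟩
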